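/- Let $d\ge 1$ and let $A=\begin{pmatrix}A_{11}&A_{12}\\A_{21}&A_{22}\end{pmatrix}\in\mathrm{GL}(2d,\mathbb{R})$, with blocks $A_{ij}\in\mathbb{R}^{d\times d}$, be right-regular, i.e. $A_{12}$ and $A_{22}$ are invertible. Let $1\le p,q\le\infty$, with conjugate exponents $p',q'$ ($\frac1p+\frac1{p'}=1=\frac1q+\frac1{q'}$). For functions $f,g$ on $\mathbb{R}^d$ put \[ \mathcal{B}_A(f,g)(x,\omega)=\int_{\mathbb{R}^d}e^{-2\pi i\omega\cdot y}\,f(A_{11}x+A_{12}y)\,\overline{g(A_{21}x+A_{22}y)}\,dy ,\qquad x,\omega\in\mathbb{R}^d, \] and let $\langle F,G\rangle=\int F\,\overline{G}$. Let $M^1(\mathbb{R}^d)$ be the Feichtinger algebra, i.e. the space of $f\in L^2(\mathbb{R}^d)$ whose short-time Fourier transform with Gaussian window is integrable on $\mathbb{R}^{2d}$. For $\sigma\in L^q(\mathbb{R}^{2d})$ the operator $\sigma^A$ is defined on $M^1(\mathbb{R}^d)$ by \[ \langle\sigma^Af,g\rangle=\langle\sigma,\mathcal{B}_A(g,f)\rangle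 ,\qquad f,g\in M^1(\mathbb{R}^d). \] Then the quantization mapping \[ \sigma\in L^q(\mathbb{R}^{2d})\mapsto\sigma^A\in\mathcal{L}(L^p(\mathbb{R}^d)) \] is continuous (that is, there is a continuous linear map $\Phi:L^q(\mathbb{R}^{2d})\to\mathcal{L}(L^p(\mathbb{R}^d))$ such that $\Phi(\sigma)$ extends $\sigma^A$ for every $\sigma\in L^q(\mathbb{R}^{2d})$) if and only if $q\le 2$ and $q\le p\le q'$. In that case one can choose the extension, again denoted $\sigma^A=\Phi(\sigma)$, so that $\langle\sigma^Af,g\rangle=\langle\sigma,\mathcal{B}_A(g,f)\rangle$, with an absolutely convergent right-hand side, for all $f\in L^p(\mathbb{R}^d)$ and $g\in L^{p'}(\mathbb{R}^d)$, and \[ \|\sigma^A\|_{L^p\to L^p}\le\frac{\|\sigma\|_{L^q}}{|\det A|^{\frac1{q'}}\,|\det A_{12}|^{\frac1{p'}-\frac1{q'}}\,|\det A_{22}|^{\frac1p-\frac1{q'}}}. \] (For $p<\infty$ the extension is unique, since $M^1(\mathbb{R}^d)$ is dense in $L^p(\mathbb{R}^d)$.) -/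

import Mathlib

open MeasureTheory
open scoped ENNReal ComplexConjugate FourierTransform

noncomputable section

namespace MatrixWigner

/-- The space `ℝ^d` with its Euclidean structure and Lebesgue measure. The phase space `ℝ^{2d}` is
`Rd d × Rd d` with the product Lebesgue measure. -/
abbrev Rd (d : ℕ) : Type := EuclideanSpace ℝ (Fin d)

/-- Real `2d × 2d` matrices with a `2 × 2` block structure of `d × d` blocks; the blocks of `A`
are `A.toBlocks₁₁`, `A.toBlocks₁₂`, `A.toBlocks₂₁`, `A.toBlocks₂₂`. -/
abbrev BlockMatrix (d : ℕ) : Type := Matrix (Fin d ⊕ Fin d) (Fin d ⊕ Fin d) ℝ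

/-- Right-regularity: the blocks `A₁₂` and `A₂₂` are invertible. -/
def RightRegular {d : ℕ} (A : BlockMatrix d) : Prop :=
  IsUnit A.toBlocks₁₂ ∧ IsUnit A.toBlocks₂₂

/-- The tensor product `f ⊗ g`. -/
def tensor {d : ℕ} (f g : Rd d → ℂ) : Rd d × Rd d → ℂ :=
  fun z => f z.1 * g z.2

/-- The bilinear coordinate transformation
`𝔗_A F (x, y) = F (A₁₁ x + A₁₂ y, A₂₁ x + A₂₂ y)`. -/
def coordTransform {d : ℕ} (A : BlockMatrix d) (F : Rd d × Rd d → ℂ) : Rd d × Rd d → ℂ :=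
  fun z => F (Matrix.toEuclideanLin A.toBlocks₁₁ z.1 + Matrix.toEuclideanLin A.toBlocks₁₂ z.2,
    Matrix.toEuclideanLin A.toBlocks₂₁ z.1 + Matrix.toEuclideanLin A.toBlocks₂₂ z.2)

/-- The partial Fourier transform in the second variable,
`𝓕₂ F (x, ω) = ∫ exp (-2 π i ω · y) F (x, y) dy`. -/
def partialFourier {d : ℕ} (F : Rd d × Rd d → ℂ) : Rd d × Rd d → ℂ :=
  fun z => 𝓕 (fun y : Rd d => F (z.1, y)) z.2

/-- The matrix-Wigner distribution `𝓑_A (f, g) = 𝓕₂ 𝔗_A (f ⊗ conj g)`. -/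
def mwd {d : ℕ} (A : BlockMatrix d) (f g : Rd d → ℂ) : Rd d × Rd d → ℂ :=
  partialFourier (coordTransform A (tensor f (fun t => conj (g t))))

/-- The short-time Fourier transform
`V_g f (x, ω) = ∫ exp (-2 π i y · ω) f (y) conj (g (y - x)) dy`. -/
def stft {d : ℕ} (g f : Rd d → ℂ) : Rd d × Rd d → ℂ :=
  fun z => 𝓕 (fun y : Rd d => f y * conj (g (y - z.1))) z.2

/-- The Gaussian window `t ↦ exp (-π |t|²)`. -/
def gaussianWindow (d : ℕ) : Rd d → ℂ :=
  fun t => (Real.exp (-Real.pi * ‖t‖ ^ 2) : ℂ)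

/-- The Feichtinger algebra `M¹(ℝ^d)`: functions whose short-time Fourier transform is integrable
on `ℝ^{2d}`. The space does not depend on the window and is contained in `L²`. -/
def MemM1 {d : ℕ} (f : Rd d → ℂ) : Prop :=
  MemLp f 2 volume ∧ Integrable (stft (gaussianWindow d) f) volume

/-- The bracket `⟨F, G⟩ = ∫ F conj G`, conjugate-linear in the second argument. -/
def bracket {X : Type*} [MeasureSpace X] (F G : X → ℂ) : ℂ :=
  ∫ x, F x * conj (G x)

/-- The sesquilinear form `⟨σ^A f, g⟩ = ⟨σ, 𝓑_A (g, f)⟩` which defines the pseudodifferential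
operator `σ^A` with symbol `σ`. -/
def opForm {d : ℕ} (A : BlockMatrix d) (σ : Rd d × Rd d → ℂ) (f g : Rd d → ℂ) : ℂ :=
  bracket σ (mwd A g f)

/-- The bounded operator `T` on `L^p(ℝ^d)` is (an extension of) the operator `σ^A`, which is defined
on `M¹(ℝ^d)` by `⟨σ^A f, g⟩ = ⟨σ, 𝓑_A (g, f)⟩` for all `g ∈ M¹(ℝ^d)`.
Since `M¹` is contained in every Lebesgue space, `f` and `g` run over the elements of
`L^p` and `L^{p'}` that lie in `M¹`. -/
def IsQuantization {d : ℕ} (A : BlockMatrix d) (p p' : ℝ≥0∞) [Fact (1 ≤ p)]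
    (σ : Rd d × Rd d → ℂ)
    (T : Lp ℂ p (volume : Measure (Rd d)) →L[ℂ] Lp ℂ p (volume : Measure (Rd d))) : Prop :=
  ∀ (f : Lp ℂ p (volume : Measure (Rd d))) (g : Lp ℂ p' (volume : Measure (Rd d))),
    MemM1 f → MemM1 g → bracket (T f) g = opForm A σ f g

end MatrixWigner

end

/-! Sufficiency rests on the bilinear estimate ‖𝓑_A(g, f)‖_{q'} ≤ C ‖g‖_{p'} ‖f‖_p
(`eLpNorm_mwd_le`). For fixed x, 𝓑_A(g, f)(x, ·) is the Fourier transform of y ↦ g(A₁₁x + A₁₂y) conj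
f(A₂₁x + A₂₂y). Hausdorff–Young, which needs q ≤ 2, bounds its L^{q'} norm by the L^q norm of this
slice. A three-factor Hölder inequality then splits |g|^q |f|^q into powers of |g|^{p'} |f|^p,
|g|^{p'} and |f|^p; the exponents are nonnegative exactly when q ≤ p ≤ q'. The last two factors,
integrated in y, do not depend on x and produce det A₁₂ and det A₂₂; the first, integrated in x and
y, produces det A. This gives the stated constant.

The operator is not obtained by duality, since L^1 is not the dual of L^∞. For integrable σ, σ^A f
is an explicit kernel integral, and the converse of Hölder's inequality (`PairingBound.eLpNorm_le`)
places it in L^p. Simple functions are dense in L^q, and the set of σ for which σ^A f lies in L^p is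
closed, so every σ is reached (`Admissible.exists_represents`).

Necessity comes from testing on Gaussians adapted to A₁₂ and A₂₂, one of them dilated by r. Then
|𝓑_A(g, f)| is dominated below by an explicit Gaussian profile, of height (1+r²)^{-d/2} and of width
about √(1+r²) in ω and at least a multiple of √(1+r²)/r in x. Pairing it with its conjugate phase on
a product of balls and letting r → ∞ gives 1/p' ≤ 1/q; letting r → 0 gives 1 ≤ 1/q + 1/p'. Together
these are q ≤ p ≤ q', and adding them gives q ≤ 2. -/

namespace MatrixWigner

/-! ### The converse of Hölder's inequality. -/

section ConverseHolder

variable {α : Type*}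

/-- The function `conj h * |h| ^ (s - 2)` on `E`, for which `h * dualTest h s E = |h| ^ s` on `E`. -/
noncomputable def dualTest (h : α → ℂ) (s : ℝ) (E : Set α) : α → ℂ :=
  E.indicator fun x => conj (h x) * ((‖h x‖ ^ (s - 2) : ℝ) : ℂ)

theorem mul_dualTest (h : α → ℂ) {s : ℝ} (hs : 0 < s) (E : Set α) (x : α) :
    h x * dualTest h s E x = ((E.indicator (fun x => ‖h x‖ ^ s) x : ℝ) : ℂ) := by
  unfold dualTest
  by_cases hx : x ∈ E
  · simp only [Set.indicator_of_mem hx]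
    rw [← mul_assoc, Complex.mul_conj, Complex.normSq_eq_norm_sq]
    rcases eq_or_ne (h x) 0 with h0 | h0
    · simp [h0, Real.zero_rpow hs.ne']
    · have h1 : 0 < ‖h x‖ := norm_pos_iff.2 h0
      rw [← Complex.ofReal_mul, ← Real.rpow_natCast, ← Real.rpow_add h1]
      norm_num
  · simp [Set.indicator_of_notMem hx]

theorem norm_dualTest_le (h : α → ℂ) (s : ℝ) (E : Set α) (x : α) :
    ‖dualTest h s E x‖ ≤ E.indicator (fun x => ‖h x‖ ^ (s - 1)) x := by
  unfold dualTest
  by_cases hx : x ∈ E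
  · simp only [Set.indicator_of_mem hx]
    rcases eq_or_ne (h x) 0 with h0 | h0
    · simp only [h0, map_zero, zero_mul, norm_zero]
      positivity
    · have h1 : 0 < ‖h x‖ := norm_pos_iff.2 h0
      rw [norm_mul, RCLike.norm_conj, Complex.norm_real, Real.norm_of_nonneg (by positivity)]
      nth_rw 1 [← Real.rpow_one ‖h x‖]
      rw [← Real.rpow_add h1]
      exact le_of_eq (by ring_nf)
  · simp [Set.indicator_of_notMem hx]

theorem dualTest_bound {h : α → ℂ} {s : ℝ} (hs : 1 ≤ s) {E : Set α} {M : ℝ}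
    (hM : ∀ x ∈ E, ‖h x‖ ≤ M) (x : α) :
    ‖dualTest h s E x‖ ≤ E.indicator (fun _ => M ^ (s - 1)) x := by
  refine (norm_dualTest_le h s E x).trans ?_
  by_cases hx : x ∈ E
  · simp only [Set.indicator_of_mem hx]
    exact Real.rpow_le_rpow (norm_nonneg _) (hM x hx) (by linarith)
  · simp [Set.indicator_of_notMem hx]

variable [MeasurableSpace α] {μ : Measure α}

theorem enorm_integral_ofReal_of_nonneg {r : α → ℝ} (hr : ∀ x, 0 ≤ r x) (hi : Integrable r μ) :
    ‖∫ x, (r x : ℂ) ∂μ‖ₑ = ∫⁻ x, ENNReal.ofReal (r x) ∂μ := by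
  rw [integral_complex_ofReal, ← ofReal_integral_eq_lintegral_ofReal hi (Filter.Eventually.of_forall hr),
    ← ofReal_norm, Complex.norm_real, Real.norm_eq_abs, abs_of_nonneg (integral_nonneg hr)]

theorem measurable_dualTest {h : α → ℂ} (hm : Measurable h) (s : ℝ) {E : Set α}
    (hE : MeasurableSet E) : Measurable (dualTest h s E) := by
  unfold dualTest
  refine Measurable.indicator ?_ hE
  fun_prop

theorem memLp_dualTest {h : α → ℂ} (hm : Measurable h) {s : ℝ} (hs : 1 ≤ s) {E : Set α}
    (hE : MeasurableSet E) (hμE : μ E ≠ ∞) {M : ℝ} (hM : ∀ x ∈ E, ‖h x‖ ≤ M) (r : ℝ≥0∞) :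
    MemLp (dualTest h s E) r μ := by
  refine (memLp_indicator_const (p := r) hE (M ^ (s - 1)) (Or.inr hμE)).of_le
    (measurable_dualTest hm s hE).aestronglyMeasurable
    (Filter.Eventually.of_forall fun x => ?_)
  exact (dualTest_bound hs hM x).trans (Real.le_norm_self _)

theorem integrable_mul_dualTest {h : α → ℂ} (hm : Measurable h) {s : ℝ} (hs : 1 ≤ s) {E : Set α}
    (hE : MeasurableSet E) (hμE : μ E ≠ ∞) {M : ℝ} (hM : ∀ x ∈ E, ‖h x‖ ≤ M) :
    Integrable (E.indicator fun x => ‖h x‖ ^ s) μ := by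
  refine ((integrable_indicator_iff hE).2
    (integrableOn_const hμE (C := M ^ s))).mono'
    ((by fun_prop : Measurable fun x => ‖h x‖ ^ s).indicator hE).aestronglyMeasurable
    (Filter.Eventually.of_forall fun x => ?_)
  by_cases hx : x ∈ E
  · simp only [Set.indicator_of_mem hx]
    rw [Real.norm_of_nonneg (by positivity)]
    exact Real.rpow_le_rpow (norm_nonneg _) (hM x hx) (by linarith)
  · simp [Set.indicator_of_notMem hx]

theorem enorm_integral_mul_dualTest {h : α → ℂ} (hm : Measurable h) {s : ℝ} (hs : 1 ≤ s)
    {E : Set α} (hE : MeasurableSet E) (hμE : μ E ≠ ∞) {M : ℝ} (hM : ∀ x ∈ E, ‖h x‖ ≤ M) :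
    ‖∫ x, h x * dualTest h s E x ∂μ‖ₑ = ∫⁻ x in E, ‖h x‖ₑ ^ s ∂μ := by
  simp only [mul_dualTest h (by linarith : 0 < s)]
  rw [enorm_integral_ofReal_of_nonneg
    (fun x => Set.indicator_nonneg (fun _ _ => by positivity) x)
    (integrable_mul_dualTest hm hs hE hμE hM), ← lintegral_indicator hE]
  refine lintegral_congr fun x => ?_
  by_cases hx : x ∈ E
  · simp only [Set.indicator_of_mem hx]
    rw [← ENNReal.ofReal_rpow_of_nonneg (norm_nonneg _) (by linarith), ofReal_norm]
  · simp [Set.indicator_of_notMem hx]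

/-- The hypothesis of the converse of Hölder's inequality: the pairing with `h` is bounded by
`C` times the `p'`-norm on bounded integrable functions. -/
def PairingBound (μ : Measure α) (h : α → ℂ) (p' C : ℝ≥0∞) : Prop :=
  ∀ g : α → ℂ, MemLp g 1 μ → MemLp g ∞ μ → Integrable (fun x => h x * g x) μ →
    ‖∫ x, h x * g x ∂μ‖ₑ ≤ C * eLpNorm g p' μ

theorem PairingBound.lintegral_le {h : α → ℂ} {p' C : ℝ≥0∞} (H : PairingBound μ h p' C)
    (hm : Measurable h) {s : ℝ} (hs : 1 ≤ s)
    {E : Set α} (hE : MeasurableSet E) (hμE : μ E ≠ ∞) {M : ℝ} (hM : ∀ x ∈ E, ‖h x‖ ≤ M) :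
    ∫⁻ x in E, ‖h x‖ₑ ^ s ∂μ ≤ C * eLpNorm (dualTest h s E) p' μ := by
  rw [← enorm_integral_mul_dualTest hm hs hE hμE hM]
  refine H _ (memLp_dualTest hm hs hE hμE hM _) (memLp_dualTest hm hs hE hμE hM _) ?_
  simp only [mul_dualTest h (by linarith : 0 < s)]
  exact (integrable_mul_dualTest hm hs hE hμE hM).ofReal

/-- With I = ∫_E |h|^p, testing on `dualTest h p E` gives I ≤ C · I^{1 - 1/p}, from which one
divides. -/
theorem PairingBound.setLIntegral_rpow_le {h : α → ℂ} {p p' C : ℝ≥0∞}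
    (hp : p.HolderConjugate p') (hpt : p ≠ ∞) (H : PairingBound μ h p' C)
    (hm : Measurable h)
    {E : Set α} (hE : MeasurableSet E) (hμE : μ E ≠ ∞) {M : ℝ} (hM : ∀ x ∈ E, ‖h x‖ ≤ M) :
    (∫⁻ x in E, ‖h x‖ₑ ^ p.toReal ∂μ) ^ p.toReal⁻¹ ≤ C := by
  have hp1 : 1 ≤ p := hp.one_le
  have hs : 1 ≤ p.toReal := by simpa using ENNReal.toReal_mono hpt hp1
  set s := p.toReal with hsdef
  set I := ∫⁻ x in E, ‖h x‖ₑ ^ s ∂μ with hI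
  -- Finiteness, from the boundedness of h on the finite-measure set E, is what permits the final
  -- cancellation.
  have hIfin : I ≠ ∞ := by
    rw [hI, ← enorm_integral_mul_dualTest hm hs hE hμE hM]
    exact enorm_ne_top
  have h1 : I ≤ C * eLpNorm (dualTest h s E) p' μ := H.lintegral_le hm hs hE hμE hM
  -- The test function has modulus at most |h|^{s-1}, and (s - 1) p' = s. For p = 1 it is merely
  -- bounded by 1.
  have h2 : eLpNorm (dualTest h s E) p' μ ≤ I ^ (1 - s⁻¹) := by
    rcases eq_or_ne p 1 with rfl | hp1'
    · have : p' = ∞ := by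
        have := hp.inv_add_inv_eq_one
        simpa using this
      subst this
      have hs1 : s = 1 := by simp [hsdef]
      rw [hs1]
      simp only [inv_one, sub_self, ENNReal.rpow_zero]
      refine eLpNorm_le_of_ae_bound (C := 1) (Filter.Eventually.of_forall fun x => ?_) |>.trans
        (by simp)
      refine (dualTest_bound le_rfl hM x).trans ?_
      by_cases hx : x ∈ E <;> simp [hx]
    · have hpp : p.toReal.HolderConjugate p'.toReal := by
        refine ENNReal.HolderConjugate.toReal_of_ne_top hpt ?_
        rintro rfl
        exact hp1' (by simpa using hp.inv_add_inv_eq_one)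
      have ht := hpp.symm.pos
      have hp'0 : p' ≠ 0 := fun h => by simp [h] at ht
      have hp't : p' ≠ ∞ := fun h => by simp [h] at ht
      have hst : 1 - s⁻¹ = 1 / p'.toReal := by
        rw [one_div]; exact hpp.one_sub_inv
      rw [eLpNorm_eq_lintegral_rpow_enorm_toReal hp'0 hp't, hst]
      refine ENNReal.rpow_le_rpow ?_ (by positivity)
      rw [hI, ← lintegral_indicator hE]
      refine lintegral_mono fun x => ?_
      have h5 := norm_dualTest_le h s E x
      by_cases hx : x ∈ E
      · simp only [Set.indicator_of_mem hx] at h5 ⊢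
        rw [← ofReal_norm, ← ofReal_norm,
          ENNReal.ofReal_rpow_of_nonneg (norm_nonneg _) ht.le,
          ENNReal.ofReal_rpow_of_nonneg (norm_nonneg _) (by positivity)]
        refine ENNReal.ofReal_le_ofReal ((Real.rpow_le_rpow (norm_nonneg _) h5 ht.le).trans ?_)
        rw [← Real.rpow_mul (norm_nonneg _), hpp.sub_one_mul_conj]
      · simp only [Set.indicator_of_notMem hx] at h5 ⊢
        rw [norm_le_zero_iff.1 h5, enorm_zero, ENNReal.zero_rpow_of_pos ht]
  rcases eq_or_ne I 0 with h0 | h0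
  · rw [h0, ENNReal.zero_rpow_of_pos (by positivity)]
    exact zero_le
  · have h3 : I ^ s⁻¹ * I ^ (1 - s⁻¹) ≤ C * I ^ (1 - s⁻¹) := by
      rw [← ENNReal.rpow_add _ _ h0 hIfin]
      simpa using h1.trans (mul_le_mul_right h2 C)
    exact (ENNReal.mul_le_mul_iff_left (by simp [h0, hIfin]) (by simp [h0, hIfin])).1 h3

/-- The sets on which a function is bounded by `n`, cut down to finite measure. -/
def levelCut (μ : Measure α) [SigmaFinite μ] (h : α → ℂ) (n : ℕ) : Set α :=
  spanningSets μ n ∩ {x | ‖h x‖ ≤ n}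

theorem measurableSet_levelCut [SigmaFinite μ] {h : α → ℂ} (hm : Measurable h) (n : ℕ) :
    MeasurableSet (levelCut μ h n) :=
  (measurableSet_spanningSets μ n).inter (measurableSet_le hm.norm measurable_const)

theorem measure_levelCut_ne_top [SigmaFinite μ] (h : α → ℂ) (n : ℕ) :
    μ (levelCut μ h n) ≠ ∞ :=
  ((measure_mono Set.inter_subset_left).trans_lt (measure_spanningSets_lt_top μ n)).ne

theorem monotone_levelCut [SigmaFinite μ] (h : α → ℂ) : Monotone (levelCut μ h) := by
  intro m n hmn
  refine Set.inter_subset_inter (monotone_spanningSets μ hmn) fun x hx => ?_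
  have : (m : ℝ) ≤ n := by exact_mod_cast hmn
  exact le_trans (by exact hx) this

theorem iUnion_levelCut [SigmaFinite μ] (h : α → ℂ) : ⋃ n, levelCut μ h n = Set.univ := by
  refine Set.eq_univ_of_forall fun x => Set.mem_iUnion.2 ?_
  obtain ⟨n, hn⟩ := exists_nat_ge ‖h x‖
  have hx : x ∈ ⋃ n, spanningSets μ n := by rw [iUnion_spanningSets]; trivial
  obtain ⟨m, hm⟩ := Set.mem_iUnion.1 hx
  refine ⟨max m n, monotone_spanningSets μ (le_max_left m n) hm, ?_⟩
  exact hn.trans (by exact_mod_cast le_max_right m n)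

/-- If |h| > C on a set E of positive finite measure, pairing with the conjugate phase of h on E
gives C μ(E) < ∫_E |h| ≤ C μ(E). -/
theorem PairingBound.eLpNormEssSup_le [SigmaFinite μ] {h : α → ℂ} {C : ℝ≥0∞}
    (H : PairingBound μ h 1 C) (hm : Measurable h) : eLpNormEssSup h μ ≤ C := by
  rcases eq_or_ne C ∞ with rfl | hC
  · exact le_top
  refine essSup_le_of_ae_le _ ?_
  have key : ∀ n, μ (levelCut μ h n ∩ {x | C < ‖h x‖ₑ}) = 0 := by
    intro n
    set E := levelCut μ h n ∩ {x | C < ‖h x‖ₑ} with hEdef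
    have hE : MeasurableSet E :=
      (measurableSet_levelCut hm n).inter (measurableSet_lt measurable_const hm.enorm)
    have hμE : μ E ≠ ∞ :=
      ne_top_of_le_ne_top (measure_levelCut_ne_top h n) (measure_mono Set.inter_subset_left)
    have hM : ∀ x ∈ E, ‖h x‖ ≤ n := fun x hx => hx.1.2
    have h1 := H.lintegral_le hm le_rfl hE hμE hM
    have h2 : eLpNorm (dualTest h 1 E) 1 μ ≤ μ E := by
      rw [eLpNorm_one_eq_lintegral_enorm, ← lintegral_indicator_one hE]
      refine lintegral_mono fun x => ?_
      have h3 := dualTest_bound le_rfl hM x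
      by_cases hx : x ∈ E
      · simp only [Set.indicator_of_mem hx, sub_self, Real.rpow_zero, Pi.one_apply] at h3 ⊢
        rw [← ofReal_norm]
        simpa using ENNReal.ofReal_le_ofReal h3
      · simp only [Set.indicator_of_notMem hx] at h3 ⊢
        rw [norm_le_zero_iff.1 h3, enorm_zero]
    by_contra hne
    have h4 : ∫⁻ _ in E, C ∂μ < ∫⁻ x in E, ‖h x‖ₑ ∂μ := by
      refine setLIntegral_strict_mono hE hne hm.enorm ?_
        (Filter.Eventually.of_forall fun x hx => hx.2)
      rw [setLIntegral_const]
      exact ENNReal.mul_ne_top hC hμE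
    rw [setLIntegral_const] at h4
    simp only [ENNReal.rpow_one] at h1
    exact absurd (h1.trans (mul_le_mul_right h2 C)) (not_le.2 h4)
  have h0 : μ (⋃ n, levelCut μ h n ∩ {x | C < ‖h x‖ₑ}) = 0 := measure_iUnion_null key
  rw [← Set.iUnion_inter, iUnion_levelCut, Set.univ_inter] at h0
  simpa [Filter.EventuallyLE, ae_iff] using h0

/-- The sets `levelCut` increase to the whole space, so the bound on each passes to the limit by
monotone convergence. -/
theorem PairingBound.eLpNorm_le_of_measurable [SigmaFinite μ] {h : α → ℂ} {p p' C : ℝ≥0∞}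
    (hp : p.HolderConjugate p') (H : PairingBound μ h p' C) (hm : Measurable h) :
    eLpNorm h p μ ≤ C := by
  rcases eq_or_ne p ∞ with rfl | hpt
  · have : p' = 1 := by
      have := hp.inv_add_inv_eq_one
      simpa using this
    subst this
    rw [eLpNorm_exponent_top]
    exact H.eLpNormEssSup_le hm
  have hp0 : p ≠ 0 := (zero_lt_one.trans_le hp.one_le).ne'
  have hs : 0 < p.toReal := ENNReal.toReal_pos hp0 hpt
  rw [eLpNorm_eq_lintegral_rpow_enorm_toReal hp0 hpt, one_div]
  have h1 : ∀ n, ∫⁻ x in levelCut μ h n, ‖h x‖ₑ ^ p.toReal ∂μ ≤ C ^ p.toReal := by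
    intro n
    have := H.setLIntegral_rpow_le hp hpt hm (measurableSet_levelCut hm n)
      (measure_levelCut_ne_top h n) (M := n) (fun x hx => hx.2)
    exact (ENNReal.rpow_inv_le_iff hs).1 this
  rw [ENNReal.rpow_inv_le_iff hs, ← setLIntegral_univ, ← iUnion_levelCut h (μ := μ),
    setLIntegral_iUnion_of_directed _ (monotone_levelCut h).directed_le]
  exact iSup_le h1

/-- The converse of Hölder's inequality. -/
theorem PairingBound.eLpNorm_le [SigmaFinite μ] {h : α → ℂ} {p p' C : ℝ≥0∞}
    (hp : p.HolderConjugate p') (H : PairingBound μ h p' C) (hm : AEStronglyMeasurable h μ) :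
    eLpNorm h p μ ≤ C := by
  rw [eLpNorm_congr_ae hm.ae_eq_mk]
  refine PairingBound.eLpNorm_le_of_measurable hp ?_ hm.stronglyMeasurable_mk.measurable
  intro g hg1 hg2 hi
  have hae : (fun x => h x * g x) =ᵐ[μ] fun x => hm.mk h x * g x := by
    filter_upwards [hm.ae_eq_mk] with x hx
    rw [hx]
  rw [← integral_congr_ae hae]
  exact H g hg1 hg2 (hi.congr hae.symm)

end ConverseHolder

/-! ### Endpoint Fourier estimates and the analytic family for Hausdorff–Young. -/

section HausdorffYoung

variable {V : Type*} [NormedAddCommGroup V] [InnerProductSpace ℝ V] [FiniteDimensional ℝ V]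
  [MeasurableSpace V] [BorelSpace V]

theorem continuous_fourier {f : V → ℂ} (hf : Integrable f) : Continuous (𝓕 f) :=
  VectorFourier.fourierIntegral_continuous Real.continuous_fourierChar
    (by exact continuous_inner) hf

theorem norm_fourier_le (f : V → ℂ) (w : V) : ‖𝓕 f w‖ ≤ ∫ v, ‖f v‖ :=
  VectorFourier.norm_fourierIntegral_le_integral_norm _ _ _ _ _

theorem enorm_fourier_le (f : V → ℂ) (w : V) : ‖𝓕 f w‖ₑ ≤ eLpNorm f 1 volume := by
  rw [eLpNorm_one_eq_lintegral_enorm, Real.fourier_eq]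
  refine (enorm_integral_le_lintegral_enorm _).trans (le_of_eq ?_)
  refine lintegral_congr fun v => ?_
  rw [← ofReal_norm, ← ofReal_norm, Circle.norm_smul]

theorem integral_fourier_mul_eq {f g : V → ℂ} (hf : Integrable f) (hg : Integrable g) :
    ∫ w, 𝓕 f w * g w = ∫ v, f v * 𝓕 g v := by
  have := VectorFourier.integral_fourierIntegral_smul_eq_flip (L := innerₗ V)
    Real.continuous_fourierChar continuous_inner hf hg
  rw [flip_innerₗ] at this
  exact this

/-- On `L¹ ∩ L²` the Fourier integral agrees with the `L²` Fourier transform. -/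
theorem fourier_toLp_ae_eq {f : V → ℂ} (hf : Integrable f) (hf2 : MemLp f 2 volume) :
    (𝓕 (hf2.toLp f) : Lp (α := V) ℂ 2 (volume : Measure V)) =ᵐ[volume] 𝓕 f := by
  refine ae_eq_of_integral_contDiff_smul_eq
    ((Lp.memLp _).locallyIntegrable (by norm_num))
    ((continuous_fourier hf).locallyIntegrable (μ := volume)) fun g hg hgc => ?_
  have hgc' : HasCompactSupport (fun x => (g x : ℂ)) := hgc.comp_left (g := Complex.ofReal) rfl
  have hg' : ContDiff ℝ ((⊤ : ℕ∞) : WithTop ℕ∞) (fun x => (g x : ℂ)) :=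
    Complex.ofRealCLM.contDiff.comp hg
  let φ : SchwartzMap V ℂ := hgc'.toSchwartzMap hg'
  -- The L² transform is the distributional one, which acts by transposition onto the test function;
  -- the Fourier integral obeys the same transposition rule.
  have h1 := congrArg (fun T : TemperedDistribution V ℂ => T φ) (Lp.fourier_toTemperedDistribution_eq (hf2.toLp f))
  simp only [TemperedDistribution.fourier_apply, Lp.toTemperedDistribution_apply] at h1
  have hφ : ∀ x, φ x = (g x : ℂ) := fun x => rfl
  have h2 : ∫ x, 𝓕 φ x • (hf2.toLp f) x = ∫ x, φ x * 𝓕 f x := by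
    rw [← integral_fourier_mul_eq (φ.integrable (μ := volume)) hf]
    refine integral_congr_ae ?_
    filter_upwards [hf2.coeFn_toLp] with x hx
    rw [hx, SchwartzMap.fourier_coe, smul_eq_mul]
  rw [h2] at h1
  simpa [hφ] using h1.symm

theorem eLpNorm_fourier_two {f : V → ℂ} (hf : Integrable f) (hf2 : MemLp f 2 volume) :
    eLpNorm (𝓕 f) 2 volume = eLpNorm f 2 volume := by
  rw [← eLpNorm_congr_ae (fourier_toLp_ae_eq hf hf2), ← eLpNorm_congr_ae hf2.coeFn_toLp,
    ← Lp.enorm_def, ← Lp.enorm_def, ← ofReal_norm, ← ofReal_norm, Lp.norm_fourier_eq]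

theorem enorm_integral_fourier_mul_le_one {f g : V → ℂ} (hg : Integrable g) :
    ‖∫ w, 𝓕 f w * g w‖ₑ ≤ eLpNorm f 1 volume * eLpNorm g 1 volume := by
  refine (enorm_integral_le_lintegral_enorm _).trans ?_
  rw [eLpNorm_one_eq_lintegral_enorm (f := g),
    ← lintegral_const_mul'' _ hg.aestronglyMeasurable.enorm]
  refine lintegral_mono fun w => ?_
  rw [enorm_mul]
  gcongr
  exact enorm_fourier_le f w

theorem enorm_integral_fourier_mul_le_two {f g : V → ℂ} (hf : Integrable f)
    (hf2 : MemLp f 2 volume) (hg2 : MemLp g 2 volume) :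
    ‖∫ w, 𝓕 f w * g w‖ₑ ≤ eLpNorm f 2 volume * eLpNorm g 2 volume := by
  rw [← eLpNorm_fourier_two hf hf2]
  refine (enorm_integral_le_lintegral_enorm _).trans ?_
  rw [← eLpNorm_one_eq_lintegral_enorm]
  have h := eLpNorm_smul_le_mul_eLpNorm (p := 2) (q := 2) (r := 1) hg2.1
    (continuous_fourier hf).aestronglyMeasurable
  exact h

/-- The analytic family `a |a| ^ (s (1 - z / 2) - 1)` interpolating the complex number `a`. -/
noncomputable def interpVal (s : ℝ) (z a : ℂ) : ℂ :=
  if a = 0 then 0 else a / ‖a‖ * (‖a‖ : ℂ) ^ (s * (1 - z / 2))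

@[simp] theorem interpVal_zero (s : ℝ) (z : ℂ) : interpVal s z 0 = 0 := by simp [interpVal]

/-- The exponent is s on Re z = 0 and s/2 on Re z = 1, so the family carries L^s data to L¹ on one
edge of the strip and to L² on the other. -/
theorem norm_interpVal {s : ℝ} {z : ℂ} (h : 0 < s * (1 - z.re / 2)) (a : ℂ) :
    ‖interpVal s z a‖ = ‖a‖ ^ (s * (1 - z.re / 2)) := by
  unfold interpVal
  split_ifs with ha
  · simp [ha, Real.zero_rpow h.ne']
  · have h1 : 0 < ‖a‖ := norm_pos_iff.2 ha
    rw [norm_mul, norm_div, Complex.norm_real, norm_norm, div_self h1.ne', one_mul,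
      Complex.norm_cpow_eq_rpow_re_of_pos h1]
    congr 1
    simp

theorem interpVal_self {s : ℝ} {z : ℂ} (h : (s : ℂ) * (1 - z / 2) = 1) (a : ℂ) :
    interpVal s z a = a := by
  unfold interpVal
  split_ifs with ha
  · exact ha.symm
  · have h1 : (‖a‖ : ℂ) ≠ 0 := by simpa using ha
    rw [h, Complex.cpow_one, div_mul_cancel₀ _ h1]

theorem differentiable_interpVal (s : ℝ) (a : ℂ) : Differentiable ℂ fun z => interpVal s z a := by
  unfold interpVal
  split_ifs with ha
  · exact differentiable_const _
  · have h1 : (‖a‖ : ℂ) ≠ 0 := by simpa using ha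
    intro z
    refine DifferentiableAt.const_mul ?_ _
    refine DifferentiableAt.const_cpow (by fun_prop) (Or.inl h1)

theorem fourier_finset_sum {ι : Type*} (t : Finset ι) (c : ι → ℂ) (u : ι → V → ℂ)
    (hu : ∀ i ∈ t, Integrable (u i)) (w : V) :
    𝓕 (fun v => ∑ i ∈ t, c i * u i v) w = ∑ i ∈ t, c i * 𝓕 (u i) w := by
  simp only [Real.fourier_eq, Finset.smul_sum]
  rw [integral_finsetSum]
  · refine Finset.sum_congr rfl fun i _ => ?_
    rw [← integral_const_mul]
    refine integral_congr_ae (Filter.Eventually.of_forall fun v => ?_)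
    simp only [Circle.smul_def, smul_eq_mul]
    ring
  · intro i hi
    have := (Real.fourierIntegral_convergent_iff (μ := volume) w).2 ((hu i hi).const_mul (c i))
    exact this

theorem simpleFunc_map_eq_sum {α : Type*} [MeasurableSpace α] (f : SimpleFunc α ℂ) (φ : ℂ → ℂ)
    (v : α) : φ (f v) = ∑ a ∈ f.range, φ a * (f ⁻¹' {a}).indicator (fun _ => (1 : ℂ)) v := by
  rw [Finset.sum_eq_single (f v)]
  · simp
  · intro b _ hb
    have : v ∉ f ⁻¹' {b} := fun h => hb (by simpa using h.symm)
    simp [this]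
  · intro h
    exact absurd (SimpleFunc.mem_range_self f v) h

/-- The pairing `∫ 𝓕 (f_z) g_z` for the analytic families through simple functions. -/
noncomputable def interpPairing (s : ℝ) (f g : SimpleFunc V ℂ) (z : ℂ) : ℂ :=
  ∫ w, 𝓕 (fun v => interpVal s z (f v)) w * interpVal s z (g w)

theorem integrable_indicator_fiber {f : SimpleFunc V ℂ} (hf : Integrable f) {a : ℂ} (ha : a ≠ 0) :
    Integrable ((f ⁻¹' {a}).indicator (fun _ => (1 : ℂ))) := by
  refine (integrable_indicator_iff (f.measurableSet_fiber a)).2 (integrableOn_const ?_)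
  exact ((SimpleFunc.integrable_iff (f := f)).1 hf a ha).ne

/-- In this finite sum z occurs only in scalar factors, which makes holomorphy and boundedness on
the strip evident. The value 0 is left out because its fibre may have infinite measure. -/
theorem interpPairing_eq_sum (s : ℝ) {f g : SimpleFunc V ℂ} (hf : Integrable f)
    (hg : Integrable g) (z : ℂ) :
    interpPairing s f g z = ∑ a ∈ f.range with a ≠ 0, ∑ b ∈ g.range with b ≠ 0,
      interpVal s z a * interpVal s z b *
        ∫ w, 𝓕 ((f ⁻¹' {a}).indicator (fun _ => (1 : ℂ))) w *
          (g ⁻¹' {b}).indicator (fun _ => (1 : ℂ)) w := by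
  have key : ∀ (h : SimpleFunc V ℂ) (v : V), interpVal s z (h v) =
      ∑ a ∈ h.range with a ≠ 0,
        interpVal s z a * (h ⁻¹' {a}).indicator (fun _ => (1 : ℂ)) v := by
    intro h v
    rw [simpleFunc_map_eq_sum h (interpVal s z) v]
    refine (Finset.sum_subset (Finset.filter_subset _ _) fun a ha ha' => ?_).symm
    have : a = 0 := by
      by_contra hne
      exact ha' (Finset.mem_filter.2 ⟨ha, hne⟩)
    simp [this]
  unfold interpPairing
  have hF : ∀ w, 𝓕 (fun v => interpVal s z (f v)) w = ∑ a ∈ f.range with a ≠ 0,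
      interpVal s z a * 𝓕 ((f ⁻¹' {a}).indicator (fun _ => (1 : ℂ))) w := by
    intro w
    simp only [key f]
    exact fourier_finset_sum _ _ _
      (fun a ha => integrable_indicator_fiber hf (Finset.mem_filter.1 ha).2) w
  have hint : ∀ a ∈ f.range.filter (· ≠ 0), ∀ b ∈ g.range.filter (· ≠ 0),
      Integrable (fun w => 𝓕 ((f ⁻¹' {a}).indicator (fun _ => (1 : ℂ))) w *
          (g ⁻¹' {b}).indicator (fun _ => (1 : ℂ)) w) := by
    intro a ha b hb
    exact (integrable_indicator_fiber hg (Finset.mem_filter.1 hb).2).bdd_mul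
      (continuous_fourier (integrable_indicator_fiber hf
        (Finset.mem_filter.1 ha).2)).aestronglyMeasurable
      (Filter.Eventually.of_forall fun w => norm_fourier_le _ w)
  simp only [hF, key g, Finset.sum_mul_sum]
  have hre : ∀ a b : ℂ, ∀ w : V,
      interpVal s z a * 𝓕 ((f ⁻¹' {a}).indicator (fun _ => (1 : ℂ))) w *
        (interpVal s z b * (g ⁻¹' {b}).indicator (fun _ => (1 : ℂ)) w) =
      interpVal s z a * interpVal s z b *
        (𝓕 ((f ⁻¹' {a}).indicator (fun _ => (1 : ℂ))) w *
          (g ⁻¹' {b}).indicator (fun _ => (1 : ℂ)) w) := fun a b w => by ring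
  simp only [hre]
  rw [integral_finsetSum _ fun a ha => integrable_finsetSum _ fun b hb =>
    (hint a ha b hb).const_mul _]
  refine Finset.sum_congr rfl fun a ha => ?_
  rw [integral_finsetSum _ fun b hb => (hint a ha b hb).const_mul _]
  refine Finset.sum_congr rfl fun b hb => ?_
  rw [integral_const_mul]

theorem differentiable_interpPairing (s : ℝ) {f g : SimpleFunc V ℂ} (hf : Integrable f)
    (hg : Integrable g) : Differentiable ℂ (interpPairing s f g) := by
  have h : interpPairing s f g = _ := funext (interpPairing_eq_sum s hf hg)
  rw [h]
  refine Differentiable.fun_sum fun a _ => Differentiable.fun_sum fun b _ => ?_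
  exact ((differentiable_interpVal s a).mul (differentiable_interpVal s b)).mul_const _

theorem interpVal_bound {s : ℝ} (hs : 0 < s) {z : ℂ} (hz : z.re ∈ Set.Icc (0 : ℝ) 1) (a : ℂ) :
    ‖interpVal s z a‖ ≤ (1 + ‖a‖) ^ s := by
  obtain ⟨h0, h1⟩ := hz
  have h2 : 0 < s * (1 - z.re / 2) := mul_pos hs (by linarith)
  rw [norm_interpVal h2]
  refine (Real.rpow_le_rpow (norm_nonneg a) (by linarith : ‖a‖ ≤ 1 + ‖a‖) h2.le).trans ?_
  refine Real.rpow_le_rpow_of_exponent_le (by linarith [norm_nonneg a]) ?_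
  nlinarith

theorem bddAbove_interpPairing {s : ℝ} (hs : 0 < s) {f g : SimpleFunc V ℂ} (hf : Integrable f)
    (hg : Integrable g) :
    BddAbove ((norm ∘ interpPairing s f g) '' Complex.HadamardThreeLines.verticalClosedStrip 0 1) := by
  refine ⟨∑ a ∈ f.range with a ≠ 0, ∑ b ∈ g.range with b ≠ 0,
      (1 + ‖a‖) ^ s * (1 + ‖b‖) ^ s *
        ‖∫ w, 𝓕 ((f ⁻¹' {a}).indicator (fun _ => (1 : ℂ))) w *
          (g ⁻¹' {b}).indicator (fun _ => (1 : ℂ)) w‖, ?_⟩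
  rintro _ ⟨z, hz, rfl⟩
  have hz' : z.re ∈ Set.Icc (0 : ℝ) 1 := hz
  simp only [Function.comp_apply]
  rw [interpPairing_eq_sum s hf hg]
  refine (norm_sum_le _ _).trans (Finset.sum_le_sum fun a _ => (norm_sum_le _ _).trans
    (Finset.sum_le_sum fun b _ => ?_))
  rw [norm_mul, norm_mul]
  gcongr
  · exact interpVal_bound hs hz' a
  · exact interpVal_bound hs hz' b

end HausdorffYoung

/-! ### Hausdorff–Young by the three lines theorem. -/

section HausdorffYoung

variable {V : Type*} [NormedAddCommGroup V] [InnerProductSpace ℝ V] [FiniteDimensional ℝ V]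
  [MeasurableSpace V] [BorelSpace V]

theorem memLp_interpVal {f : SimpleFunc V ℂ} (hf : Integrable f) (s : ℝ) (z : ℂ) {r : ℝ≥0∞}
    (hr : r ≠ 0) (hrt : r ≠ ∞) : MemLp (fun v => interpVal s z (f v)) r volume := by
  have h1 : (f.map (interpVal s z)).FinMeasSupp volume :=
    SimpleFunc.FinMeasSupp.map (SimpleFunc.integrable_iff_finMeasSupp.1 hf) (interpVal_zero s z)
  exact (SimpleFunc.memLp_iff_finMeasSupp hr hrt).2 h1

theorem eLpNorm_interpVal (f : V → ℂ) {s : ℝ} {z : ℂ} (h : 0 < s * (1 - z.re / 2)) (r : ℝ≥0∞) :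
    eLpNorm (fun v => interpVal s z (f v)) r volume =
      eLpNorm f (r * ENNReal.ofReal (s * (1 - z.re / 2))) volume ^ (s * (1 - z.re / 2)) := by
  rw [← eLpNorm_norm_rpow _ h]
  refine eLpNorm_congr_norm_ae (Filter.Eventually.of_forall fun v => ?_)
  rw [norm_interpVal h, Real.norm_of_nonneg (by positivity)]

/-- Hadamard's three lines theorem applied to `interpPairing`: with N the product of the L^s norms,
the edges are bounded by N^s (trivial L¹ estimate) and N^{s/2} (Plancherel). -/
theorem enorm_integral_fourier_mul_le_simpleFunc {s : ℝ} (hs1 : 1 < s) (hs2 : s < 2)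
    {f g : SimpleFunc V ℂ} (hf : Integrable f) (hg : Integrable g) :
    ‖∫ w, 𝓕 (⇑f : V → ℂ) w * g w‖ₑ ≤
      eLpNorm f (ENNReal.ofReal s) volume * eLpNorm g (ENNReal.ofReal s) volume := by
  have hs0 : 0 < s := by linarith
  have hsr : ENNReal.ofReal s ≠ 0 := by simpa using hs0
  have hfin : ∀ {h : SimpleFunc V ℂ}, Integrable h → eLpNorm h (ENNReal.ofReal s) volume ≠ ∞ :=
    fun {h} hh => ((SimpleFunc.memLp_iff_finMeasSupp hsr ENNReal.ofReal_ne_top).2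
      (SimpleFunc.integrable_iff_finMeasSupp.1 hh)).2.ne
  set N := eLpNorm f (ENNReal.ofReal s) volume * eLpNorm g (ENNReal.ofReal s) volume with hN
  have hNfin : N ≠ ∞ := ENNReal.mul_ne_top (hfin hf) (hfin hg)
  have hint : ∀ {h : SimpleFunc V ℂ}, Integrable h → ∀ z,
      Integrable (fun v => interpVal s z (h v)) := fun hh z =>
    memLp_one_iff_integrable.1 (memLp_interpVal hh s z one_ne_zero ENNReal.one_ne_top)
  have edge0 : ∀ z : ℂ, z ∈ Complex.re ⁻¹' {0} → ‖interpPairing s f g z‖ ≤ N.toReal ^ s := by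
    intro z hz
    have hz : z.re = 0 := hz
    have hpos : 0 < s * (1 - z.re / 2) := by rw [hz]; linarith
    have h1 := enorm_integral_fourier_mul_le_one (f := fun v => interpVal s z (f v)) (hint hg z)
    rw [eLpNorm_interpVal _ hpos, eLpNorm_interpVal _ hpos, hz, one_mul, zero_div, sub_zero,
      mul_one, ← ENNReal.mul_rpow_of_nonneg _ _ hs0.le] at h1
    have h2 := ENNReal.toReal_mono (ENNReal.rpow_ne_top_of_nonneg hs0.le hNfin) h1
    rwa [toReal_enorm, ← ENNReal.toReal_rpow] at h2
  have edge1 : ∀ z : ℂ, z ∈ Complex.re ⁻¹' {1} → ‖interpPairing s f g z‖ ≤ N.toReal ^ (s / 2) := by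
    intro z hz
    have hz : z.re = 1 := hz
    have hpos : 0 < s * (1 - z.re / 2) := by rw [hz]; linarith
    have h1 := enorm_integral_fourier_mul_le_two (hint hf z)
      (memLp_interpVal hf s z two_ne_zero ENNReal.ofNat_ne_top)
      (memLp_interpVal hg s z two_ne_zero ENNReal.ofNat_ne_top)
    have h3 : s * (1 - 1 / 2) = s / 2 := by ring
    have h4 : 2 * ENNReal.ofReal (s / 2) = ENNReal.ofReal s := by
      rw [← ENNReal.ofReal_ofNat, ← ENNReal.ofReal_mul (by norm_num)]
      congr 1
      ring
    rw [eLpNorm_interpVal _ hpos, eLpNorm_interpVal _ hpos, hz, h3, h4,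
      ← ENNReal.mul_rpow_of_nonneg _ _ (by positivity)] at h1
    have h2 := ENNReal.toReal_mono (ENNReal.rpow_ne_top_of_nonneg (by positivity) hNfin) h1
    rwa [toReal_enorm, ← ENNReal.toReal_rpow] at h2
  -- This θ solves s(1 - θ/2) = 1: there the family returns f and g, and the interpolated bound
  -- N^{s(1-θ)} · N^{(s/2)θ} equals N.
  set θ : ℝ := 2 - 2 / s with hθ
  have hθ0 : 0 ≤ θ := by rw [hθ, sub_nonneg, div_le_iff₀ hs0]; linarith
  have hθ1 : θ ≤ 1 := by
    have : 1 ≤ 2 / s := by rw [le_div_iff₀ hs0]; linarith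
    linarith
  have hθs : s * (1 - θ / 2) = 1 := by rw [hθ]; field_simp; ring
  have key := Complex.HadamardThreeLines.norm_le_interp_of_mem_verticalClosedStrip₀₁'
    (interpPairing s f g) (z := (θ : ℂ)) (a := N.toReal ^ s) (b := N.toReal ^ (s / 2))
    (by simpa [Complex.HadamardThreeLines.verticalClosedStrip] using ⟨hθ0, hθ1⟩)
    (differentiable_interpPairing s hf hg).diffContOnCl
    (bddAbove_interpPairing hs0 hf hg) edge0 edge1
  have hself : interpPairing s f g θ = ∫ w, 𝓕 (⇑f : V → ℂ) w * g w := by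
    have : (s : ℂ) * (1 - (θ : ℂ) / 2) = 1 := by exact_mod_cast hθs
    simp only [interpPairing, interpVal_self this]
  rw [hself, Complex.ofReal_re, ← Real.rpow_mul ENNReal.toReal_nonneg,
    ← Real.rpow_mul ENNReal.toReal_nonneg] at key
  have hadd : N.toReal ^ (s * (1 - θ)) * N.toReal ^ (s / 2 * θ) = N.toReal := by
    rw [← Real.rpow_add_of_nonneg ENNReal.toReal_nonneg
      (mul_nonneg hs0.le (by linarith)) (by positivity)]
    have : s * (1 - θ) + s / 2 * θ = 1 := by linear_combination hθs
    rw [this, Real.rpow_one]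
  rw [hadd] at key
  rw [← ENNReal.ofReal_toReal hNfin, ← ofReal_norm]
  exact ENNReal.ofReal_le_ofReal key

/-- A bound for the pairing `∫ 𝓕 f * g` extends from simple functions `f` to `L¹ ∩ L^q`. -/
theorem enorm_integral_fourier_mul_le_of_simpleFunc {q C : ℝ≥0∞} (hq1 : 1 ≤ q) (hqt : q ≠ ∞)
    (hC : C ≠ ∞) {g : V → ℂ} (hg : Integrable g)
    (H : ∀ f : SimpleFunc V ℂ, Integrable f →
      ‖∫ w, 𝓕 (⇑f : V → ℂ) w * g w‖ₑ ≤ eLpNorm f q volume * C)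
    {f : V → ℂ} (hf : Integrable f) (hfq : MemLp f q volume) :
    ‖∫ w, 𝓕 f w * g w‖ₑ ≤ eLpNorm f q volume * C := by
  wlog hm : Measurable f generalizing f
  · have hae := hf.1.ae_eq_mk
    have h1 := this (hf.congr hae) (hfq.ae_eq hae) hf.1.stronglyMeasurable_mk.measurable
    have h2 : 𝓕 f = 𝓕 (hf.1.mk f) := funext fun w => Real.fourier_congr_ae hae w
    rwa [← h2, ← eLpNorm_congr_ae hae] at h1
  -- The same approximants converge in L¹ and in L^q: the L¹ error controls the pairing, the L^q
  -- error the right-hand side.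
  set F := fun n => SimpleFunc.approxOn f hm (Set.range f ∪ {0}) 0 (by simp) n with hF
  have t1 : Filter.Tendsto (fun n => eLpNorm (⇑(F n) - f) 1 volume) Filter.atTop (nhds 0) :=
    SimpleFunc.tendsto_approxOn_range_Lp_eLpNorm ENNReal.one_ne_top hm
      (memLp_one_iff_integrable.2 hf).2
  have tq : Filter.Tendsto (fun n => eLpNorm (⇑(F n) - f) q volume) Filter.atTop (nhds 0) :=
    SimpleFunc.tendsto_approxOn_range_Lp_eLpNorm hqt hm hfq.2
  have hFi : ∀ n, Integrable (F n) := fun n =>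
    memLp_one_iff_integrable.1 (SimpleFunc.memLp_approxOn_range hm
      (memLp_one_iff_integrable.2 hf) n)
  have bound : ∀ n, ‖∫ w, 𝓕 f w * g w‖ₑ ≤
      (eLpNorm (⇑(F n) - f) q volume + eLpNorm f q volume) * C +
        eLpNorm (⇑(F n) - f) 1 volume * eLpNorm g 1 volume := by
    intro n
    have hmul : ∀ {u : V → ℂ}, Integrable u → Integrable fun w => 𝓕 u w * g w := fun hu =>
      hg.bdd_mul (continuous_fourier hu).aestronglyMeasurable
        (Filter.Eventually.of_forall fun w => norm_fourier_le _ w)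
    have hsub : ∀ w, 𝓕 f w = 𝓕 (⇑(F n) : V → ℂ) w - 𝓕 (⇑(F n) - f) w := by
      intro w
      have hc : ∀ {u : V → ℂ}, Integrable u → Integrable fun v => Real.fourierChar (-inner ℝ v w) • u v :=
        fun hu => (Real.fourierIntegral_convergent_iff (μ := volume) w).2 hu
      simp only [Real.fourier_eq]
      rw [← integral_sub (hc (hFi n)) (hc ((hFi n).sub hf))]
      simp [smul_sub]
    have h1 : ∫ w, 𝓕 f w * g w =
        (∫ w, 𝓕 (⇑(F n) : V → ℂ) w * g w) - ∫ w, 𝓕 (⇑(F n) - f) w * g w := by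
      rw [← integral_sub (hmul (hFi n)) (hmul ((hFi n).sub hf))]
      simp only [hsub, sub_mul]
    rw [h1]
    refine (enorm_sub_le).trans (add_le_add ((H _ (hFi n)).trans ?_)
      (enorm_integral_fourier_mul_le_one hg))
    gcongr
    have h2 : ⇑(F n) = (⇑(F n) - f) + f := by simp
    nth_rw 1 [h2]
    exact eLpNorm_add_le (((hFi n).sub hf).1) hf.1 hq1
  have hlim : Filter.Tendsto (fun n => (eLpNorm (⇑(F n) - f) q volume + eLpNorm f q volume) * C +
        eLpNorm (⇑(F n) - f) 1 volume * eLpNorm g 1 volume) Filter.atTop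
      (nhds ((0 + eLpNorm f q volume) * C + 0 * eLpNorm g 1 volume)) := by
    refine Filter.Tendsto.add ?_ ?_
    · exact ENNReal.Tendsto.mul_const (tq.add tendsto_const_nhds) (Or.inr hC)
    · exact ENNReal.Tendsto.mul_const t1 (Or.inr (memLp_one_iff_integrable.2 hg).2.ne)
  rw [zero_add, zero_mul, add_zero] at hlim
  exact ge_of_tendsto' hlim bound

/-- Density is used twice, once in each argument; transposing the Fourier transform exchanges their
roles. -/
theorem enorm_integral_fourier_mul_le {s : ℝ} (hs1 : 1 < s) (hs2 : s < 2)
    {f g : V → ℂ} (hf : Integrable f) (hfs : MemLp f (ENNReal.ofReal s) volume)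
    (hg : Integrable g) (hgs : MemLp g (ENNReal.ofReal s) volume) :
    ‖∫ w, 𝓕 f w * g w‖ₑ ≤
      eLpNorm f (ENNReal.ofReal s) volume * eLpNorm g (ENNReal.ofReal s) volume := by
  have h1 : 1 ≤ ENNReal.ofReal s := by
    rw [← ENNReal.ofReal_one]; exact ENNReal.ofReal_le_ofReal hs1.le
  have h0 : ENNReal.ofReal s ≠ 0 := (zero_lt_one.trans_le h1).ne'
  refine enorm_integral_fourier_mul_le_of_simpleFunc h1 ENNReal.ofReal_ne_top hgs.2.ne hg
    (fun u hu => ?_) hf hfs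
  have hus : MemLp u (ENNReal.ofReal s) volume :=
    (SimpleFunc.memLp_iff_finMeasSupp h0 ENNReal.ofReal_ne_top).2
      (SimpleFunc.integrable_iff_finMeasSupp.1 hu)
  have hflip : ∀ {v : V → ℂ}, Integrable v → ∫ w, 𝓕 (⇑u : V → ℂ) w * v w = ∫ w, 𝓕 v w * u w := by
    intro v hv
    rw [integral_fourier_mul_eq hu hv]
    exact integral_congr_ae (Filter.Eventually.of_forall fun w => mul_comm _ _)
  rw [hflip hg, mul_comm]
  refine enorm_integral_fourier_mul_le_of_simpleFunc h1 ENNReal.ofReal_ne_top hus.2.ne hu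
    (fun v hv => ?_) hg hgs
  exact enorm_integral_fourier_mul_le_simpleFunc hs1 hs2 hv hu

theorem memLp_of_memLp_one_of_memLp_top {α : Type*} [MeasurableSpace α] {μ : Measure α}
    {g : α → ℂ} (h1 : MemLp g 1 μ) (hi : MemLp g ∞ μ) {q : ℝ≥0∞} (hq1 : 1 ≤ q) (hqt : q ≠ ∞) :
    MemLp g q μ := by
  have hs : 1 ≤ q.toReal := by simpa using ENNReal.toReal_mono hqt hq1
  rw [← integrable_norm_rpow_iff h1.1 (zero_lt_one.trans_le hq1).ne' hqt]
  have hb : ∀ᵐ x ∂μ, ‖g x‖ ≤ (eLpNorm g ∞ μ).toReal := by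
    rw [eLpNorm_exponent_top]
    filter_upwards [ae_le_eLpNormEssSup (f := g) (μ := μ)] with x hx
    rw [← toReal_enorm]
    exact ENNReal.toReal_mono (by simpa using hi.2.ne) hx
  refine ((memLp_one_iff_integrable.1 h1).norm.const_mul
    ((eLpNorm g ∞ μ).toReal ^ (q.toReal - 1))).mono'
    (h1.1.norm.aemeasurable.pow_const _).aestronglyMeasurable ?_
  filter_upwards [hb] with x hx
  rw [Real.norm_of_nonneg (by positivity)]
  calc ‖g x‖ ^ q.toReal = ‖g x‖ ^ (q.toReal - 1) * ‖g x‖ := by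
        nth_rw 3 [← Real.rpow_one ‖g x‖]
        rw [← Real.rpow_add_of_nonneg (norm_nonneg _) (by linarith) zero_le_one]
        norm_num
    _ ≤ _ := by gcongr

/-- The Hausdorff–Young inequality for integrable functions. -/
theorem eLpNorm_fourier_le {q q' : ℝ≥0∞} (hq : q.HolderConjugate q') (hq2 : q ≤ 2)
    {f : V → ℂ} (hf : Integrable f) : eLpNorm (𝓕 f) q' volume ≤ eLpNorm f q volume := by
  have hq1 : 1 ≤ q := hq.one_le
  have hqt : q ≠ ∞ := ne_top_of_le_ne_top ENNReal.ofNat_ne_top hq2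
  by_cases hfin : eLpNorm f q volume = ∞
  · rw [hfin]; exact le_top
  have hfq : MemLp f q volume := ⟨hf.1, lt_top_iff_ne_top.2 hfin⟩
  rcases eq_or_lt_of_le hq1 with rfl | hq1'
  · have : q' = ∞ := by simpa using hq.inv_add_inv_eq_one
    rw [this, eLpNorm_exponent_top]
    exact essSup_le_of_ae_le _ (Filter.Eventually.of_forall fun w => enorm_fourier_le f w)
  rcases eq_or_lt_of_le hq2 with rfl | hq2'
  · have : q' = 2 := by
      have h := hq.inv_add_inv_eq_one
      rw [← ENNReal.inv_two_add_inv_two] at h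
      exact inv_injective ((ENNReal.add_right_inj (by simp)).1 h)
    rw [this]
    exact (eLpNorm_fourier_two hf hfq).le
  obtain ⟨s, hs⟩ : ∃ s : ℝ, q = ENNReal.ofReal s := ⟨q.toReal, (ENNReal.ofReal_toReal hqt).symm⟩
  have hs1 : 1 < s := by
    rw [hs, ← ENNReal.ofReal_one] at hq1'
    exact (ENNReal.ofReal_lt_ofReal_iff_of_nonneg zero_le_one).1 hq1'
  have hs2 : s < 2 := by
    rw [hs, ← ENNReal.ofReal_ofNat] at hq2'
    exact (ENNReal.ofReal_lt_ofReal_iff two_pos).1 hq2'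
  -- For 1 < q < 2 the norm estimate is dual to the pairing estimate against g in L¹ ∩ L^∞, hence in
  -- L^q.
  refine PairingBound.eLpNorm_le hq.symm ?_ (continuous_fourier hf).aestronglyMeasurable
  intro g hg1 hgi _
  have hgq : MemLp g q volume :=
    memLp_of_memLp_one_of_memLp_top hg1 hgi hq1 hqt
  subst hs
  exact enorm_integral_fourier_mul_le hs1 hs2 hf hfq (memLp_one_iff_integrable.1 hg1) hgq

end HausdorffYoung

/-! ### Affine and block-linear changes of variables. -/

section ChangeOfVariables

variable {d : ℕ}

theorem det_toEuclideanLin (M : Matrix (Fin d) (Fin d) ℝ) :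
    LinearMap.det (Matrix.toEuclideanLin M) = M.det := by
  change LinearMap.det (Matrix.toLpLin 2 2 M) = M.det
  rw [Matrix.toLpLin_eq_toLin, LinearMap.det_toLin]

/-- The Jacobian factor `|det M|⁻¹` as an extended nonnegative real. -/
noncomputable def jac {ι : Type*} [Fintype ι] [DecidableEq ι] (M : Matrix ι ι ℝ) : ℝ≥0∞ :=
  ENNReal.ofReal |M.det|⁻¹

theorem abs_det_pos {ι : Type*} [Fintype ι] [DecidableEq ι] {M : Matrix ι ι ℝ} (hM : IsUnit M) :
    0 < |M.det| :=
  abs_pos.2 ((Matrix.isUnit_iff_isUnit_det M).1 hM).ne_zero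

theorem jac_ne_zero {ι : Type*} [Fintype ι] [DecidableEq ι] {M : Matrix ι ι ℝ} (hM : IsUnit M) :
    jac M ≠ 0 := by
  have := abs_det_pos hM
  simpa [jac] using this

theorem jac_ne_top {ι : Type*} [Fintype ι] [DecidableEq ι] (M : Matrix ι ι ℝ) :
    jac M ≠ ∞ := ENNReal.ofReal_ne_top

theorem measurable_affine (M : Matrix (Fin d) (Fin d) ℝ) (v : Rd d) :
    Measurable fun y : Rd d => v + Matrix.toEuclideanLin M y :=
  (measurable_const_add v).comp
    (LinearMap.continuous_of_finiteDimensional (Matrix.toEuclideanLin M)).measurable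

theorem map_affine_volume {M : Matrix (Fin d) (Fin d) ℝ} (hM : IsUnit M) (v : Rd d) :
    (volume : Measure (Rd d)).map (fun y => v + Matrix.toEuclideanLin M y) = jac M • volume := by
  have h1 : LinearMap.det (Matrix.toEuclideanLin M) ≠ 0 := by
    rw [det_toEuclideanLin]
    exact ((Matrix.isUnit_iff_isUnit_det M).1 hM).ne_zero
  have h2 := Measure.map_linearMap_addHaar_eq_smul_addHaar (volume : Measure (Rd d)) h1
  have h3 : (fun y => v + Matrix.toEuclideanLin M y) =
      (fun y : Rd d => v + y) ∘ Matrix.toEuclideanLin M := rfl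
  rw [h3, ← Measure.map_map (measurable_const_add v)
    (LinearMap.continuous_of_finiteDimensional (Matrix.toEuclideanLin M)).measurable, h2,
    Measure.map_smul, map_add_left_eq_self, det_toEuclideanLin, abs_inv]
  rfl

theorem lintegral_comp_affine {M : Matrix (Fin d) (Fin d) ℝ} (hM : IsUnit M) (v : Rd d)
    {F : Rd d → ℝ≥0∞} (hF : Measurable F) :
    ∫⁻ y, F (v + Matrix.toEuclideanLin M y) = jac M * ∫⁻ u, F u := by
  rw [← lintegral_map (g := fun y => v + Matrix.toEuclideanLin M y) hF (measurable_affine M v),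
    map_affine_volume hM, lintegral_smul_measure, smul_eq_mul]

theorem eLpNorm_comp_affine {M : Matrix (Fin d) (Fin d) ℝ} (hM : IsUnit M) (v : Rd d)
    {F : Rd d → ℂ} (hF : Measurable F) (r : ℝ≥0∞) :
    eLpNorm (fun y => F (v + Matrix.toEuclideanLin M y)) r volume =
      jac M ^ (r⁻¹).toReal * eLpNorm F r volume := by
  have h1 := eLpNorm_map_measure (p := r) (f := fun y => v + Matrix.toEuclideanLin M y)
    (μ := (volume : Measure (Rd d))) hF.aestronglyMeasurable (measurable_affine M v).aemeasurable
  rw [map_affine_volume hM, eLpNorm_smul_measure_of_ne_zero (jac_ne_zero hM)] at h1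
  rw [one_div, smul_eq_mul] at h1
  exact h1.symm

/-- The linear map `(x, y) ↦ (A₁₁ x + A₁₂ y, A₂₁ x + A₂₂ y)`. -/
noncomputable def blockLin (A : BlockMatrix d) : Rd d × Rd d →ₗ[ℝ] Rd d × Rd d :=
  LinearMap.prod
    (LinearMap.coprod (Matrix.toEuclideanLin A.toBlocks₁₁) (Matrix.toEuclideanLin A.toBlocks₁₂))
    (LinearMap.coprod (Matrix.toEuclideanLin A.toBlocks₂₁) (Matrix.toEuclideanLin A.toBlocks₂₂))

theorem blockLin_apply (A : BlockMatrix d) (z : Rd d × Rd d) : blockLin A z =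
    (Matrix.toEuclideanLin A.toBlocks₁₁ z.1 + Matrix.toEuclideanLin A.toBlocks₁₂ z.2,
      Matrix.toEuclideanLin A.toBlocks₂₁ z.1 + Matrix.toEuclideanLin A.toBlocks₂₂ z.2) := rfl

theorem det_blockLin (A : BlockMatrix d) : LinearMap.det (blockLin A) = A.det := by
  let b := (EuclideanSpace.basisFun (Fin d) ℝ).toBasis.prod
    (EuclideanSpace.basisFun (Fin d) ℝ).toBasis
  rw [← LinearMap.det_toMatrix b]
  congr 1
  ext i j
  rw [LinearMap.toMatrix_apply]
  rcases i with i | i <;> rcases j with j | j <;>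
    simp [b, blockLin_apply, Matrix.toBlocks₁₁, Matrix.toBlocks₁₂, Matrix.toBlocks₂₁,
      Matrix.toBlocks₂₂, Matrix.toLpLin_apply, Matrix.mulVec_single]

theorem lintegral_comp_blockLin {A : BlockMatrix d} (hA : IsUnit A)
    {F : Rd d × Rd d → ℝ≥0∞} (hF : Measurable F) :
    ∫⁻ z, F (blockLin A z) = jac A * ∫⁻ z, F z := by
  have h1 : LinearMap.det (blockLin A) ≠ 0 := by
    rw [det_blockLin]
    exact ((Matrix.isUnit_iff_isUnit_det A).1 hA).ne_zero
  have : (volume : Measure (Rd d × Rd d)).IsAddHaarMeasure :=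
    inferInstanceAs ((volume : Measure (Rd d)).prod volume).IsAddHaarMeasure
  have h2 := Measure.map_linearMap_addHaar_eq_smul_addHaar
    (volume : Measure (Rd d × Rd d)) h1
  rw [← lintegral_map hF
    (LinearMap.continuous_of_finiteDimensional (blockLin A)).measurable, h2,
    lintegral_smul_measure, smul_eq_mul, det_blockLin, abs_inv]
  rfl

end ChangeOfVariables

/-! ### A three-factor Hölder inequality. -/

section MixedHolder

/-- The three-factor Hölder inequality behind Young's inequality for convolutions. -/
theorem lintegral_rpow_mul_rpow_le {α : Type*} [MeasurableSpace α] {μ : Measure α}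
    {u v : α → ℝ≥0∞} (hu : Measurable u) (hv : Measurable v)
    {p p' q q' : ℝ} (hp : 0 < p) (hp' : 0 < p') (hq : 0 < q) (hq' : 0 < q')
    (hpp : p⁻¹ + p'⁻¹ = 1) (hqq : q⁻¹ + q'⁻¹ = 1) (h1 : q'⁻¹ ≤ p⁻¹) (h2 : q'⁻¹ ≤ p'⁻¹) :
    ∫⁻ x, u x ^ q * v x ^ q ∂μ ≤
      (∫⁻ x, u x ^ p' * v x ^ p ∂μ) ^ (q * q'⁻¹) *
        (∫⁻ x, u x ^ p' ∂μ) ^ (q * (p'⁻¹ - q'⁻¹)) *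
        (∫⁻ x, v x ^ p ∂μ) ^ (q * (p⁻¹ - q'⁻¹)) := by
  have e0 : 0 ≤ q * q'⁻¹ := by positivity
  have e1 : 0 ≤ q * (p'⁻¹ - q'⁻¹) := mul_nonneg hq.le (by linarith)
  have e2 : 0 ≤ q * (p⁻¹ - q'⁻¹) := mul_nonneg hq.le (by linarith)
  -- The three exponents add up to q(1/p + 1/p' - 1/q') = q(1 - 1/q') = 1.
  have key := ENNReal.lintegral_prod_norm_pow_le (μ := μ) (Finset.univ : Finset (Fin 3))
    (f := ![fun x => u x ^ p' * v x ^ p, fun x => u x ^ p', fun x => v x ^ p])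
    (p := ![q * q'⁻¹, q * (p'⁻¹ - q'⁻¹), q * (p⁻¹ - q'⁻¹)])
    (by
      intro i _
      fin_cases i
      · exact ((hu.pow_const _).mul (hv.pow_const _)).aemeasurable
      · exact (hu.pow_const _).aemeasurable
      · exact (hv.pow_const _).aemeasurable)
    (by
      simp only [Fin.sum_univ_three, Matrix.cons_val_zero, Matrix.cons_val_one, Matrix.cons_val]
      have : q * q⁻¹ = 1 := mul_inv_cancel₀ hq.ne'
      linear_combination q * hpp - q * hqq + this)
    (by
      intro i _
      fin_cases i
      · exact e0
      · exact e1
      · exact e2)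
  simp only [Fin.prod_univ_three, Matrix.cons_val_zero, Matrix.cons_val_one,
    Matrix.cons_val] at key
  refine le_trans (le_of_eq (lintegral_congr fun x => ?_)) key
  rw [ENNReal.mul_rpow_of_nonneg _ _ e0, ← ENNReal.rpow_mul, ← ENNReal.rpow_mul,
    ← ENNReal.rpow_mul, ← ENNReal.rpow_mul]
  have a1 : u x ^ q = u x ^ (p' * (q * q'⁻¹)) * u x ^ (p' * (q * (p'⁻¹ - q'⁻¹))) := by
    rw [← ENNReal.rpow_add_of_nonneg _ _ (by positivity) (mul_nonneg hp'.le e1)]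
    congr 1
    field_simp
    ring
  have a2 : v x ^ q = v x ^ (p * (q * q'⁻¹)) * v x ^ (p * (q * (p⁻¹ - q'⁻¹))) := by
    rw [← ENNReal.rpow_add_of_nonneg _ _ (by positivity) (mul_nonneg hp.le e2)]
    congr 1
    field_simp
    ring
  rw [a1, a2]
  ring

end MixedHolder

/-! ### Pointwise and mixed-norm bounds for the matrix-Wigner distribution. -/

section Boundedness

variable {d : ℕ}

/-- The function whose Fourier transform is `𝓑_A (g, f) (x, ·)`. -/
noncomputable def slice (A : BlockMatrix d) (g f : Rd d → ℂ) (x y : Rd d) : ℂ :=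
  g (Matrix.toEuclideanLin A.toBlocks₁₁ x + Matrix.toEuclideanLin A.toBlocks₁₂ y) *
    conj (f (Matrix.toEuclideanLin A.toBlocks₂₁ x + Matrix.toEuclideanLin A.toBlocks₂₂ y))

theorem mwd_apply (A : BlockMatrix d) (g f : Rd d → ℂ) (x ω : Rd d) :
    mwd A g f (x, ω) = 𝓕 (slice A g f x) ω := rfl

theorem measurable_blockLin (A : BlockMatrix d) : Measurable (blockLin A) :=
  (LinearMap.continuous_of_finiteDimensional (blockLin A)).measurable

theorem measurable_slice (A : BlockMatrix d) {f g : Rd d → ℂ} (hf : Measurable f)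
    (hg : Measurable g) : Measurable fun z : Rd d × Rd d => slice A g f z.1 z.2 := by
  have h1 : Measurable fun z : Rd d × Rd d => g (blockLin A z).1 :=
    hg.comp (measurable_fst.comp (measurable_blockLin A))
  have h2 : Measurable fun z : Rd d × Rd d => conj (f (blockLin A z).2) :=
    Complex.continuous_conj.measurable.comp
      (hf.comp (measurable_snd.comp (measurable_blockLin A)))
  exact h1.mul h2

theorem measurable_slice_right (A : BlockMatrix d) {f g : Rd d → ℂ} (hf : Measurable f)
    (hg : Measurable g) (x : Rd d) : Measurable (slice A g f x) := by
  change Measurable fun y => (fun z : Rd d × Rd d => slice A g f z.1 z.2) (x, y)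
  exact (measurable_slice A hf hg).comp measurable_prodMk_left

theorem enorm_slice (A : BlockMatrix d) (g f : Rd d → ℂ) (x y : Rd d) :
    ‖slice A g f x y‖ₑ =
      ‖g (Matrix.toEuclideanLin A.toBlocks₁₁ x + Matrix.toEuclideanLin A.toBlocks₁₂ y)‖ₑ *
      ‖f (Matrix.toEuclideanLin A.toBlocks₂₁ x + Matrix.toEuclideanLin A.toBlocks₂₂ y)‖ₑ := by
  rw [slice, enorm_mul, RCLike.enorm_conj]

theorem stronglyMeasurable_mwd (A : BlockMatrix d) {f g : Rd d → ℂ} (hf : Measurable f)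
    (hg : Measurable g) : StronglyMeasurable (mwd A g f) := by
  have h0 : Continuous fun w : (Rd d × Rd d) × Rd d =>
      Complex.exp (((-2 * Real.pi * inner ℝ w.2 w.1.2 : ℝ) : ℂ) * Complex.I) := by fun_prop
  have hm : Measurable fun w : (Rd d × Rd d) × Rd d => (w.1.1, w.2) := by fun_prop
  have h1 := (measurable_slice A hf hg).comp hm
  have h2 := StronglyMeasurable.integral_prod_right' (ν := (volume : Measure (Rd d)))
    (h0.measurable.mul h1).stronglyMeasurable
  have h3 : mwd A g f = fun z => ∫ y : Rd d,
      Complex.exp (((-2 * Real.pi * inner ℝ y z.2 : ℝ) : ℂ) * Complex.I) * slice A g f z.1 y :=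
    funext fun z => Real.fourier_eq' (slice A g f z.1) z.2
  rw [h3]
  exact h2

/-- Hölder in y after the substitutions by A₁₂ and A₂₂. The bound is uniform in x; it settles the
case q = 1 and justifies Fubini for the kernel. -/
theorem eLpNorm_slice_one_le {A : BlockMatrix d} (hreg : RightRegular A) {p p' : ℝ≥0∞}
    (hp : p.HolderConjugate p') {f g : Rd d → ℂ} (hf : Measurable f) (hg : Measurable g)
    (x : Rd d) :
    eLpNorm (slice A g f x) 1 volume ≤
      jac A.toBlocks₁₂ ^ (p'⁻¹).toReal * jac A.toBlocks₂₂ ^ (p⁻¹).toReal *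
        (eLpNorm g p' volume * eLpNorm f p volume) := by
  have h1 := eLpNorm_comp_affine hreg.1 (Matrix.toEuclideanLin A.toBlocks₁₁ x) hg p'
  have h2 := eLpNorm_comp_affine hreg.2 (Matrix.toEuclideanLin A.toBlocks₂₁ x) hf p
  have hp' := hp.symm
  have h3 := eLpNorm_smul_le_mul_eLpNorm (μ := (volume : Measure (Rd d)))
    (f := fun y => conj (f (Matrix.toEuclideanLin A.toBlocks₂₁ x +
      Matrix.toEuclideanLin A.toBlocks₂₂ y)))
    (φ := fun y => g (Matrix.toEuclideanLin A.toBlocks₁₁ x +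
      Matrix.toEuclideanLin A.toBlocks₁₂ y)) (p := p') (q := p) (r := 1)
    (Complex.continuous_conj.measurable.comp
      (hf.comp (measurable_affine _ _))).aestronglyMeasurable
    (hg.comp (measurable_affine _ _)).aestronglyMeasurable
  have h4 : eLpNorm (fun y => conj (f (Matrix.toEuclideanLin A.toBlocks₂₁ x +
      Matrix.toEuclideanLin A.toBlocks₂₂ y))) p volume =
      eLpNorm (fun y => f (Matrix.toEuclideanLin A.toBlocks₂₁ x +
      Matrix.toEuclideanLin A.toBlocks₂₂ y)) p volume :=
    eLpNorm_congr_norm_ae (Filter.Eventually.of_forall fun y => RCLike.norm_conj _)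
  rw [h4, h1, h2] at h3
  refine le_trans h3 (le_of_eq ?_)
  ring

theorem integrable_slice {A : BlockMatrix d} (hreg : RightRegular A) {p p' : ℝ≥0∞}
    (hp : p.HolderConjugate p') {f g : Rd d → ℂ} (hfm : Measurable f) (hgm : Measurable g)
    (hf : MemLp f p volume) (hg : MemLp g p' volume) (x : Rd d) :
    Integrable (slice A g f x) := by
  rw [← memLp_one_iff_integrable]
  refine ⟨(measurable_slice_right A hfm hgm x).aestronglyMeasurable,
    (eLpNorm_slice_one_le hreg hp hfm hgm x).trans_lt ?_⟩
  refine ENNReal.mul_lt_top (ENNReal.mul_lt_top ?_ ?_) (ENNReal.mul_lt_top hg.2 hf.2)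
  · exact ENNReal.rpow_lt_top_of_nonneg ENNReal.toReal_nonneg (jac_ne_top _)
  · exact ENNReal.rpow_lt_top_of_nonneg ENNReal.toReal_nonneg (jac_ne_top _)

theorem enorm_mwd_le {A : BlockMatrix d} (hreg : RightRegular A) {p p' : ℝ≥0∞}
    (hp : p.HolderConjugate p') {f g : Rd d → ℂ} (hf : Measurable f) (hg : Measurable g)
    (z : Rd d × Rd d) :
    ‖mwd A g f z‖ₑ ≤
      jac A.toBlocks₁₂ ^ (p'⁻¹).toReal * jac A.toBlocks₂₂ ^ (p⁻¹).toReal *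
        (eLpNorm g p' volume * eLpNorm f p volume) :=
  (enorm_fourier_le (slice A g f z.1) z.2).trans (eLpNorm_slice_one_le hreg hp hf hg z.1)

/-- Right-regularity makes the last two Hölder factors independent of x, by an affine substitution
in y; only the first factor keeps x. -/
theorem lintegral_slice_le {A : BlockMatrix d} (hreg : RightRegular A)
    {f g : Rd d → ℂ} (hf : Measurable f) (hg : Measurable g)
    {p p' q q' : ℝ} (hp : 0 < p) (hp' : 0 < p') (hq : 0 < q) (hq' : 0 < q')
    (hpp : p⁻¹ + p'⁻¹ = 1) (hqq : q⁻¹ + q'⁻¹ = 1) (h1 : q'⁻¹ ≤ p⁻¹) (h2 : q'⁻¹ ≤ p'⁻¹)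
    (x : Rd d) :
    ∫⁻ y, ‖slice A g f x y‖ₑ ^ q ≤
      (∫⁻ y, ‖g (blockLin A (x, y)).1‖ₑ ^ p' * ‖f (blockLin A (x, y)).2‖ₑ ^ p) ^ (q * q'⁻¹) *
        (jac A.toBlocks₁₂ * ∫⁻ u, ‖g u‖ₑ ^ p') ^ (q * (p'⁻¹ - q'⁻¹)) *
        (jac A.toBlocks₂₂ * ∫⁻ u, ‖f u‖ₑ ^ p) ^ (q * (p⁻¹ - q'⁻¹)) := by
  rw [← lintegral_comp_affine hreg.1 (Matrix.toEuclideanLin A.toBlocks₁₁ x)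
      (F := fun u => ‖g u‖ₑ ^ p') (hg.enorm.pow_const _),
    ← lintegral_comp_affine hreg.2 (Matrix.toEuclideanLin A.toBlocks₂₁ x)
      (F := fun u => ‖f u‖ₑ ^ p) (hf.enorm.pow_const _)]
  refine le_trans (le_of_eq (lintegral_congr fun y => ?_)) (lintegral_rpow_mul_rpow_le
    (hg.comp (measurable_affine A.toBlocks₁₂ (Matrix.toEuclideanLin A.toBlocks₁₁ x))).enorm
    (hf.comp (measurable_affine A.toBlocks₂₂ (Matrix.toEuclideanLin A.toBlocks₂₁ x))).enorm
    hp hp' hq hq' hpp hqq h1 h2)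
  rw [enorm_slice, ENNReal.mul_rpow_of_nonneg _ _ hq.le]
  rfl

theorem lintegral_tensor_blockLin {A : BlockMatrix d} (hA : IsUnit A)
    {f g : Rd d → ℂ} (hf : Measurable f) (hg : Measurable g) (p p' : ℝ) :
    ∫⁻ x, ∫⁻ y, ‖g (blockLin A (x, y)).1‖ₑ ^ p' * ‖f (blockLin A (x, y)).2‖ₑ ^ p =
      jac A * ((∫⁻ u, ‖g u‖ₑ ^ p') * ∫⁻ u, ‖f u‖ₑ ^ p) := by
  have hm : Measurable fun z : Rd d × Rd d => ‖g z.1‖ₑ ^ p' * ‖f z.2‖ₑ ^ p :=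
    ((hg.comp measurable_fst).enorm.pow_const _).mul ((hf.comp measurable_snd).enorm.pow_const _)
  have hm2 : Measurable fun z : Rd d × Rd d =>
      ‖g (blockLin A z).1‖ₑ ^ p' * ‖f (blockLin A z).2‖ₑ ^ p :=
    hm.comp (measurable_blockLin A)
  have h1 := lintegral_comp_blockLin hA hm
  rw [Measure.volume_eq_prod, lintegral_prod _ hm2.aemeasurable,
    lintegral_prod_mul (hg.enorm.pow_const _).aemeasurable (hf.enorm.pow_const _).aemeasurable]
    at h1
  exact h1

/-- Hausdorff–Young in ω on each slice, then Hölder in y, then integration in x by Tonelli, where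
only the joint factor remains and the change of variables by A applies. -/
theorem lintegral_mwd_rpow_le {A : BlockMatrix d} (hA : IsUnit A) (hreg : RightRegular A)
    {f g : Rd d → ℂ} (hf : Measurable f) (hg : Measurable g)
    (hint : ∀ x, Integrable (slice A g f x))
    {p p' q q' : ℝ} (hp : 0 < p) (hp' : 0 < p') (hq : 1 ≤ q) (hq2 : q ≤ 2) (hq' : 0 < q')
    (hpp : p⁻¹ + p'⁻¹ = 1) (hqq : q⁻¹ + q'⁻¹ = 1) (h1 : q'⁻¹ ≤ p⁻¹) (h2 : q'⁻¹ ≤ p'⁻¹) :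
    ∫⁻ z, ‖mwd A g f z‖ₑ ^ q' ≤
      jac A * ((∫⁻ u, ‖g u‖ₑ ^ p') * ∫⁻ u, ‖f u‖ₑ ^ p) *
        ((jac A.toBlocks₁₂ * ∫⁻ u, ‖g u‖ₑ ^ p') ^ (q' * (p'⁻¹ - q'⁻¹)) *
        (jac A.toBlocks₂₂ * ∫⁻ u, ‖f u‖ₑ ^ p) ^ (q' * (p⁻¹ - q'⁻¹))) := by
  have hq0 : 0 < q := by linarith
  have hconj : (ENNReal.ofReal q).HolderConjugate (ENNReal.ofReal q') := by
    refine Real.HolderConjugate.ennrealOfReal ⟨by rw [hqq, inv_one], hq0, hq'⟩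
  have hHY : ∀ x, ∫⁻ ω, ‖mwd A g f (x, ω)‖ₑ ^ q' ≤ (∫⁻ y, ‖slice A g f x y‖ₑ ^ q) ^ (q' / q) := by
    intro x
    have h := eLpNorm_fourier_le hconj (by
      rw [← ENNReal.ofReal_ofNat]; exact ENNReal.ofReal_le_ofReal hq2) (hint x)
    rw [eLpNorm_eq_lintegral_rpow_enorm_toReal (by simpa using hq') ENNReal.ofReal_ne_top,
      eLpNorm_eq_lintegral_rpow_enorm_toReal (by simpa using hq0) ENNReal.ofReal_ne_top,
      ENNReal.toReal_ofReal hq'.le, ENNReal.toReal_ofReal hq0.le, one_div,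
      ENNReal.rpow_inv_le_iff hq', ← ENNReal.rpow_mul] at h
    rw [show q' / q = 1 / q * q' by ring]
    exact h
  have hslice : ∀ x, (∫⁻ y, ‖slice A g f x y‖ₑ ^ q) ^ (q' / q) ≤
      (∫⁻ y, ‖g (blockLin A (x, y)).1‖ₑ ^ p' * ‖f (blockLin A (x, y)).2‖ₑ ^ p) *
        ((jac A.toBlocks₁₂ * ∫⁻ u, ‖g u‖ₑ ^ p') ^ (q' * (p'⁻¹ - q'⁻¹)) *
        (jac A.toBlocks₂₂ * ∫⁻ u, ‖f u‖ₑ ^ p) ^ (q' * (p⁻¹ - q'⁻¹))) := by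
    intro x
    refine (ENNReal.rpow_le_rpow (lintegral_slice_le hreg hf hg hp hp' hq0 hq' hpp hqq h1 h2 x)
      (by positivity)).trans (le_of_eq ?_)
    rw [ENNReal.mul_rpow_of_nonneg _ _ (by positivity),
      ENNReal.mul_rpow_of_nonneg _ _ (by positivity), ← ENNReal.rpow_mul, ← ENNReal.rpow_mul,
      ← ENNReal.rpow_mul]
    -- The power q'/q from Hausdorff–Young gives the x-dependent factor exponent exactly 1, so it
    -- can be integrated over x.
    rw [show q * q'⁻¹ * (q' / q) = 1 by field_simp,
      show q * (p'⁻¹ - q'⁻¹) * (q' / q) = q' * (p'⁻¹ - q'⁻¹) by field_simp,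
      show q * (p⁻¹ - q'⁻¹) * (q' / q) = q' * (p⁻¹ - q'⁻¹) by field_simp, ENNReal.rpow_one,
      mul_assoc]
  rw [Measure.volume_eq_prod, lintegral_prod _
    ((stronglyMeasurable_mwd A hf hg).measurable.enorm.pow_const _).aemeasurable]
  refine (lintegral_mono fun x => (hHY x).trans (hslice x)).trans (le_of_eq ?_)
  rw [lintegral_mul_const, lintegral_tensor_blockLin hA hf hg]
  refine Measurable.lintegral_prod_right' (f := fun z : Rd d × Rd d =>
    ‖g (blockLin A z).1‖ₑ ^ p' * ‖f (blockLin A z).2‖ₑ ^ p) ?_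
  exact ((hg.comp (measurable_fst.comp (measurable_blockLin A))).enorm.pow_const _).mul
    ((hf.comp (measurable_snd.comp (measurable_blockLin A))).enorm.pow_const _)

end Boundedness

/-! ### The sharp form of the constant in the bilinear bound. -/

section NormBound

variable {d : ℕ}

/-- The constant in the boundedness of `(g, f) ↦ 𝓑_A (g, f)` from `L^{p'} × L^p` to `L^{q'}`. -/
noncomputable def mwdConst (A : BlockMatrix d) (p p' q' : ℝ≥0∞) : ℝ :=
  (|A.det| ^ (q'⁻¹).toReal * |A.toBlocks₁₂.det| ^ ((p'⁻¹).toReal - (q'⁻¹).toReal) *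
    |A.toBlocks₂₂.det| ^ ((p⁻¹).toReal - (q'⁻¹).toReal))⁻¹

theorem mwdConst_nonneg (A : BlockMatrix d) (p p' q' : ℝ≥0∞) : 0 ≤ mwdConst A p p' q' := by
  unfold mwdConst
  positivity

theorem jac_rpow {ι : Type*} [Fintype ι] [DecidableEq ι] {M : Matrix ι ι ℝ} (hM : IsUnit M)
    (t : ℝ) : jac M ^ t = ENNReal.ofReal (|M.det| ^ t)⁻¹ := by
  have := abs_det_pos hM
  rw [jac, ENNReal.ofReal_rpow_of_pos (by positivity), Real.inv_rpow this.le]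

theorem jac_rpow_mul_eq {A : BlockMatrix d} (hA : IsUnit A) (hreg : RightRegular A)
    (p p' q' : ℝ≥0∞) :
    jac A ^ (q'⁻¹).toReal * jac A.toBlocks₁₂ ^ ((p'⁻¹).toReal - (q'⁻¹).toReal) *
      jac A.toBlocks₂₂ ^ ((p⁻¹).toReal - (q'⁻¹).toReal) =
      ENNReal.ofReal (mwdConst A p p' q') := by
  rw [jac_rpow hA, jac_rpow hreg.1, jac_rpow hreg.2, mwdConst, mul_inv, mul_inv,
    ENNReal.ofReal_mul (by positivity), ENNReal.ofReal_mul (by positivity)]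

theorem holderConjugate_ne_top {p p' : ℝ≥0∞} (hp : p.HolderConjugate p') (h1 : p ≠ 1) :
    p' ≠ ∞ := by
  rintro rfl
  exact h1 (by simpa using hp.inv_add_inv_eq_one)

theorem holderConjugate_toReal_inv_add {p p' : ℝ≥0∞} (hp : p.HolderConjugate p') :
    (p⁻¹).toReal + (p'⁻¹).toReal = 1 := by
  have h := hp.inv_add_inv_eq_one
  have h1 : p⁻¹ ≠ ∞ := ne_top_of_le_ne_top ENNReal.one_ne_top (h ▸ le_self_add)
  have h2 : p'⁻¹ ≠ ∞ := ne_top_of_le_ne_top ENNReal.one_ne_top (h ▸ le_add_self)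
  rw [← ENNReal.toReal_add h1 h2, h, ENNReal.toReal_one]

/-- Here G and F stand for ∫|g|^{p'} and ∫|f|^p. Taking the q'-th root, the powers 1/q' and 1/p' -
1/q' of G recombine into ‖g‖_{p'}, and likewise for F. -/
theorem rpow_jac_bound {D D₁ D₂ G F : ℝ≥0∞} {p p' q' : ℝ} (hp : 0 < p) (hp' : 0 < p')
    (hq' : 0 < q') (h1 : q'⁻¹ ≤ p⁻¹) (h2 : q'⁻¹ ≤ p'⁻¹) :
    (D * (G * F) * ((D₁ * G) ^ (q' * (p'⁻¹ - q'⁻¹)) * (D₂ * F) ^ (q' * (p⁻¹ - q'⁻¹)))) ^ q'⁻¹ =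
      D ^ q'⁻¹ * D₁ ^ (p'⁻¹ - q'⁻¹) * D₂ ^ (p⁻¹ - q'⁻¹) * (G ^ p'⁻¹ * F ^ p⁻¹) := by
  have i0 : 0 ≤ q'⁻¹ := by positivity
  have i1 : 0 ≤ p'⁻¹ - q'⁻¹ := by linarith
  have i2 : 0 ≤ p⁻¹ - q'⁻¹ := by linarith
  have hG : G ^ p'⁻¹ = G ^ q'⁻¹ * G ^ (p'⁻¹ - q'⁻¹) := by
    rw [← ENNReal.rpow_add_of_nonneg _ _ i0 i1]; congr 1; ring
  have hF : F ^ p⁻¹ = F ^ q'⁻¹ * F ^ (p⁻¹ - q'⁻¹) := by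
    rw [← ENNReal.rpow_add_of_nonneg _ _ i0 i2]; congr 1; ring
  rw [hG, hF, ENNReal.mul_rpow_of_nonneg _ _ i0, ENNReal.mul_rpow_of_nonneg _ _ i0,
    ENNReal.mul_rpow_of_nonneg _ _ i0, ENNReal.mul_rpow_of_nonneg _ _ i0,
    ← ENNReal.rpow_mul, ← ENNReal.rpow_mul,
    show q' * (p'⁻¹ - q'⁻¹) * q'⁻¹ = p'⁻¹ - q'⁻¹ by field_simp,
    show q' * (p⁻¹ - q'⁻¹) * q'⁻¹ = p⁻¹ - q'⁻¹ by field_simp,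
    ENNReal.mul_rpow_of_nonneg _ _ i1, ENNReal.mul_rpow_of_nonneg _ _ i2]
  ring

/-- Boundedness of the matrix-Wigner distribution from `L^{p'} × L^p` to `L^{q'}`. -/
theorem eLpNorm_mwd_le {A : BlockMatrix d} (hA : IsUnit A) (hreg : RightRegular A)
    {p p' q q' : ℝ≥0∞} (hp : p.HolderConjugate p') (hq : q.HolderConjugate q')
    (hq2 : q ≤ 2) (hqp : q ≤ p) (hpq : p ≤ q') {f g : Rd d → ℂ} (hfm : Measurable f)
    (hgm : Measurable g) (hf : MemLp f p volume) (hg : MemLp g p' volume) :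
    eLpNorm (mwd A g f) q' volume ≤ ENNReal.ofReal (mwdConst A p p' q') *
      (eLpNorm g p' volume * eLpNorm f p volume) := by
  rw [← jac_rpow_mul_eq hA hreg]
  -- For q = 1 the exponents p, p' may be infinite and the uniform bound `enorm_mwd_le` is the
  -- claim. For q > 1 the constraints q ≤ p ≤ q' make all four exponents finite.
  rcases eq_or_ne q 1 with rfl | hq1
  · have : q' = ∞ := by simpa using hq.inv_add_inv_eq_one
    subst this
    simp only [ENNReal.inv_top, ENNReal.toReal_zero, sub_zero, ENNReal.rpow_zero, one_mul]
    rw [eLpNorm_exponent_top]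
    exact essSup_le_of_ae_le _ (Filter.Eventually.of_forall fun z => enorm_mwd_le hreg hp hfm hgm z)
  have hq1' : 1 < q := lt_of_le_of_ne hq.one_le (Ne.symm hq1)
  have hqt : q ≠ ∞ := ne_top_of_le_ne_top ENNReal.ofNat_ne_top hq2
  have hq't : q' ≠ ∞ := holderConjugate_ne_top hq hq1
  have hpt : p ≠ ∞ := ne_top_of_le_ne_top hq't hpq
  have hp't : p' ≠ ∞ := holderConjugate_ne_top hp (hq1'.trans_le hqp).ne'
  have hp0 : p ≠ 0 := (zero_lt_one.trans_le hp.one_le).ne'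
  have hp'0 : p' ≠ 0 := (zero_lt_one.trans_le hp.symm.one_le).ne'
  have hq0 : q ≠ 0 := (zero_lt_one.trans_le hq.one_le).ne'
  have hq'0 : q' ≠ 0 := (zero_lt_one.trans_le hq.symm.one_le).ne'
  have hpp := holderConjugate_toReal_inv_add hp
  have hqq := holderConjugate_toReal_inv_add hq
  have h1 : (q'⁻¹).toReal ≤ (p⁻¹).toReal :=
    ENNReal.toReal_mono (ENNReal.inv_ne_top.2 hp0) (ENNReal.inv_le_inv.2 hpq)
  have h3 : (p⁻¹).toReal ≤ (q⁻¹).toReal :=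
    ENNReal.toReal_mono (ENNReal.inv_ne_top.2 hq0) (ENNReal.inv_le_inv.2 hqp)
  have h2 : (q'⁻¹).toReal ≤ (p'⁻¹).toReal := by linarith
  simp only [ENNReal.toReal_inv] at *
  rw [eLpNorm_eq_lintegral_rpow_enorm_toReal hp'0 hp't,
    eLpNorm_eq_lintegral_rpow_enorm_toReal hp0 hpt,
    eLpNorm_eq_lintegral_rpow_enorm_toReal hq'0 hq't, one_div, one_div, one_div,
    ← rpow_jac_bound (ENNReal.toReal_pos hp0 hpt) (ENNReal.toReal_pos hp'0 hp't)
      (ENNReal.toReal_pos hq'0 hq't) h1 h2]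
  refine ENNReal.rpow_le_rpow ?_ (by positivity)
  refine lintegral_mwd_rpow_le hA hreg hfm hgm (integrable_slice hreg hp hfm hgm hf hg)
    (ENNReal.toReal_pos hp0 hpt) (ENNReal.toReal_pos hp'0 hp't) ?_ ?_
    (ENNReal.toReal_pos hq'0 hq't) hpp hqq h1 h2 (q := q.toReal)
  · simpa using ENNReal.toReal_mono hqt hq1'.le
  · simpa using ENNReal.toReal_mono ENNReal.ofNat_ne_top hq2

end NormBound

/-! ### The bracket as a pairing of L^p with L^{p'}. -/

section Pairing

variable {d : ℕ}

theorem aestronglyMeasurable_conj {α : Type*} [MeasurableSpace α] {μ : Measure α} {f : α → ℂ}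
    (hf : AEStronglyMeasurable f μ) : AEStronglyMeasurable (fun x => conj (f x)) μ :=
  Complex.continuous_conj.comp_aestronglyMeasurable hf

theorem eLpNorm_conj {α : Type*} [MeasurableSpace α] {μ : Measure α} (f : α → ℂ) (p : ℝ≥0∞) :
    eLpNorm (fun x => conj (f x)) p μ = eLpNorm f p μ :=
  eLpNorm_congr_norm_ae (Filter.Eventually.of_forall fun _ => RCLike.norm_conj _)

theorem memLp_conj {α : Type*} [MeasurableSpace α] {μ : Measure α} {f : α → ℂ} {p : ℝ≥0∞}
    (hf : MemLp f p μ) : MemLp (fun x => conj (f x)) p μ :=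
  ⟨aestronglyMeasurable_conj hf.1, by rw [eLpNorm_conj]; exact hf.2⟩

variable {X : Type*} [MeasureSpace X]

theorem eLpNorm_mul_conj_le {p p' : ℝ≥0∞} (hp : p.HolderConjugate p') {F G : X → ℂ}
    (hF : AEStronglyMeasurable F volume) (hG : AEStronglyMeasurable G volume) :
    eLpNorm (fun x => F x * conj (G x)) 1 volume ≤ eLpNorm F p volume * eLpNorm G p' volume := by
  have h := eLpNorm_smul_le_mul_eLpNorm (p := p) (q := p') (r := 1)
    (aestronglyMeasurable_conj hG) hF
  rw [eLpNorm_conj] at h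
  exact h

theorem integrable_mul_conj {p p' : ℝ≥0∞} (hp : p.HolderConjugate p') {F G : X → ℂ}
    (hF : MemLp F p volume) (hG : MemLp G p' volume) :
    Integrable (fun x => F x * conj (G x)) := by
  rw [← memLp_one_iff_integrable]
  exact ⟨hF.1.mul (aestronglyMeasurable_conj hG.1),
    (eLpNorm_mul_conj_le hp hF.1 hG.1).trans_lt (ENNReal.mul_lt_top hF.2 hG.2)⟩

theorem enorm_bracket_le {p p' : ℝ≥0∞} (hp : p.HolderConjugate p') {F G : X → ℂ}
    (hF : AEStronglyMeasurable F volume) (hG : AEStronglyMeasurable G volume) :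
    ‖bracket F G‖ₑ ≤ eLpNorm F p volume * eLpNorm G p' volume := by
  refine (enorm_integral_le_lintegral_enorm _).trans ?_
  rw [← eLpNorm_one_eq_lintegral_enorm]
  exact eLpNorm_mul_conj_le hp hF hG

theorem bracket_congr {F F' G G' : X → ℂ} (hF : F =ᵐ[volume] F') (hG : G =ᵐ[volume] G') :
    bracket F G = bracket F' G' := by
  refine integral_congr_ae ?_
  filter_upwards [hF, hG] with x h1 h2
  rw [h1, h2]

theorem bracket_add_left {p p' : ℝ≥0∞} (hp : p.HolderConjugate p') {F F' G : X → ℂ}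
    (hF : MemLp F p volume) (hF' : MemLp F' p volume) (hG : MemLp G p' volume) :
    bracket (F + F') G = bracket F G + bracket F' G := by
  unfold bracket
  rw [← integral_add (integrable_mul_conj hp hF hG) (integrable_mul_conj hp hF' hG)]
  simp [add_mul]

theorem bracket_add_right {p p' : ℝ≥0∞} (hp : p.HolderConjugate p') {F G G' : X → ℂ}
    (hF : MemLp F p volume) (hG : MemLp G p' volume) (hG' : MemLp G' p' volume) :
    bracket F (G + G') = bracket F G + bracket F G' := by
  unfold bracket
  rw [← integral_add (integrable_mul_conj hp hF hG) (integrable_mul_conj hp hF hG')]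
  simp [mul_add]

theorem bracket_smul_left (c : ℂ) (F G : X → ℂ) : bracket (c • F) G = c * bracket F G := by
  unfold bracket
  rw [← integral_const_mul]
  simp [mul_assoc]

theorem bracket_smul_right (c : ℂ) (F G : X → ℂ) :
    bracket F (c • G) = conj c * bracket F G := by
  unfold bracket
  rw [← integral_const_mul]
  refine integral_congr_ae (Filter.Eventually.of_forall fun x => ?_)
  simp only [Pi.smul_apply, smul_eq_mul, map_mul]
  ring

/-- The converse of Hölder's inequality for the bracket. -/
theorem eLpNorm_le_of_bracket [SigmaFinite (volume : Measure X)] {p p' : ℝ≥0∞}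
    [Fact (1 ≤ p')]
    (hp : p.HolderConjugate p') {h : X → ℂ} (hm : AEStronglyMeasurable h volume) {C : ℝ≥0∞}
    (H : ∀ g : Lp ℂ p' (volume : Measure X), ‖bracket h g‖ₑ ≤ C * ‖g‖ₑ) :
    eLpNorm h p volume ≤ C := by
  refine PairingBound.eLpNorm_le hp ?_ hm
  intro g hg1 hgi _
  have hg : MemLp g p' volume := by
    by_cases ht : p' = ∞
    · rw [ht]; exact hgi
    · exact memLp_of_memLp_one_of_memLp_top hg1 hgi hp.symm.one_le ht
  have hgc := memLp_conj hg
  have h1 := H (hgc.toLp _)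
  rw [bracket_congr Filter.EventuallyEq.rfl hgc.coeFn_toLp, Lp.enorm_def,
    eLpNorm_congr_ae hgc.coeFn_toLp, eLpNorm_conj] at h1
  simpa [bracket] using h1

theorem norm_le_of_bracket [SigmaFinite (volume : Measure X)] {p p' : ℝ≥0∞}
    [Fact (1 ≤ p)] [Fact (1 ≤ p')]
    (hp : p.HolderConjugate p') (h : Lp ℂ p (volume : Measure X)) {C : ℝ} (hC : 0 ≤ C)
    (H : ∀ g : Lp ℂ p' (volume : Measure X), ‖bracket h g‖ ≤ C * ‖g‖) : ‖h‖ ≤ C := by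
  have h1 := eLpNorm_le_of_bracket hp (Lp.aestronglyMeasurable h) (C := ENNReal.ofReal C)
    fun g => by
      rw [← ofReal_norm, ← ofReal_norm, ← ENNReal.ofReal_mul hC]
      exact ENNReal.ofReal_le_ofReal (H g)
  rw [← Lp.enorm_def, ← ofReal_norm] at h1
  exact (ENNReal.ofReal_le_ofReal_iff hC).1 h1

theorem norm_bracket_le {p p' : ℝ≥0∞} [Fact (1 ≤ p)] [Fact (1 ≤ p')]
    (hp : p.HolderConjugate p') (h : Lp ℂ p (volume : Measure X))
    (g : Lp ℂ p' (volume : Measure X)) : ‖bracket h g‖ ≤ ‖h‖ * ‖g‖ := by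
  have h1 := enorm_bracket_le hp (Lp.aestronglyMeasurable h) (Lp.aestronglyMeasurable g)
  rw [← Lp.enorm_def, ← Lp.enorm_def, ← ofReal_norm, ← ofReal_norm, ← ofReal_norm,
    ← ENNReal.ofReal_mul (norm_nonneg _)] at h1
  exact (ENNReal.ofReal_le_ofReal_iff (by positivity)).1 h1

theorem bracket_coe_add {p p' : ℝ≥0∞} [Fact (1 ≤ p)] [Fact (1 ≤ p')]
    (hp : p.HolderConjugate p') (h h' : Lp ℂ p (volume : Measure X))
    (g : Lp ℂ p' (volume : Measure X)) :
    bracket (⇑(h + h')) g = bracket h g + bracket h' g := by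
  rw [bracket_congr (Lp.coeFn_add h h') Filter.EventuallyEq.rfl]
  exact bracket_add_left hp (Lp.memLp h) (Lp.memLp h') (Lp.memLp g)

theorem bracket_coe_smul {p : ℝ≥0∞} [Fact (1 ≤ p)] (c : ℂ)
    (h : Lp ℂ p (volume : Measure X)) (g : X → ℂ) :
    bracket (⇑(c • h)) g = c * bracket h g := by
  rw [bracket_congr (Lp.coeFn_smul c h) Filter.EventuallyEq.rfl]
  exact bracket_smul_left c h g

theorem bracket_coe_sub {p p' : ℝ≥0∞} [Fact (1 ≤ p)] [Fact (1 ≤ p')]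
    (hp : p.HolderConjugate p') (h h' : Lp ℂ p (volume : Measure X))
    (g : Lp ℂ p' (volume : Measure X)) :
    bracket (⇑(h - h')) g = bracket h g - bracket h' g := by
  have h1 : h - h' = h + (-1 : ℂ) • h' := by rw [neg_one_smul, sub_eq_add_neg]
  rw [h1, bracket_coe_add hp, bracket_coe_smul]
  ring

/-- L^{p'} separates the points of L^p for every p, endpoints included; this is the uniqueness from
which linearity of the quantization will follow. -/
theorem eq_of_bracket_eq [SigmaFinite (volume : Measure X)] {p p' : ℝ≥0∞}
    [Fact (1 ≤ p)] [Fact (1 ≤ p')]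
    (hp : p.HolderConjugate p') {h h' : Lp ℂ p (volume : Measure X)}
    (H : ∀ g : Lp ℂ p' (volume : Measure X), bracket h g = bracket h' g) : h = h' := by
  rw [← sub_eq_zero, ← norm_le_zero_iff]
  refine norm_le_of_bracket hp _ le_rfl fun g => ?_
  rw [bracket_coe_sub hp, H g, sub_self, norm_zero, zero_mul]

end Pairing

/-! ### Linearity, bounds and closedness for the form of σ^A. -/

section Form

variable {d : ℕ}

theorem ae_eq_comp_affine {M : Matrix (Fin d) (Fin d) ℝ} (hM : IsUnit M) (v : Rd d)
    {f f' : Rd d → ℂ} (h : f =ᵐ[volume] f') :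
    (fun y => f (v + Matrix.toEuclideanLin M y)) =ᵐ[volume]
      fun y => f' (v + Matrix.toEuclideanLin M y) := by
  have hq : Measure.QuasiMeasurePreserving (fun y : Rd d => v + Matrix.toEuclideanLin M y)
      volume volume := by
    refine ⟨measurable_affine M v, ?_⟩
    rw [map_affine_volume hM]
    exact Measure.smul_absolutelyContinuous
  exact hq.ae_eq_comp h

/-- The equality holds at every point: the invertible blocks A₁₂, A₂₂ pull null sets back to null
sets in y for each fixed x, and the integral in y ignores them. -/
theorem mwd_congr {A : BlockMatrix d} (hreg : RightRegular A) {f f' g g' : Rd d → ℂ}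
    (hg : g =ᵐ[volume] g') (hf : f =ᵐ[volume] f') : mwd A g f = mwd A g' f' := by
  funext z
  refine Real.fourier_congr_ae (f₁ := slice A g f z.1) (f₂ := slice A g' f' z.1) ?_ z.2
  filter_upwards [ae_eq_comp_affine hreg.1 (Matrix.toEuclideanLin A.toBlocks₁₁ z.1) hg,
    ae_eq_comp_affine hreg.2 (Matrix.toEuclideanLin A.toBlocks₂₁ z.1) hf] with y h1 h2
  simp only [slice, h1, h2]

theorem fourier_add_apply {f g : Rd d → ℂ} (hf : Integrable f) (hg : Integrable g) (w : Rd d) :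
    𝓕 (fun v => f v + g v) w = 𝓕 f w + 𝓕 g w := by
  have := fourier_finset_sum (Finset.univ : Finset (Fin 2)) (fun _ => 1) ![f, g]
    (by intro i _; fin_cases i <;> assumption) w
  simpa using this

theorem fourier_const_mul_apply {f : Rd d → ℂ} (hf : Integrable f) (c : ℂ) (w : Rd d) :
    𝓕 (fun v => c * f v) w = c * 𝓕 f w := by
  have := fourier_finset_sum (Finset.univ : Finset (Fin 1)) (fun _ => c) ![f]
    (by intro i _; fin_cases i; assumption) w
  simpa using this

/-- The hypotheses under which the quantization map is bounded. -/
structure Admissible (A : BlockMatrix d) (p p' q q' : ℝ≥0∞) : Prop where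
  isUnit : IsUnit A
  rightRegular : RightRegular A
  conj_p : p.HolderConjugate p'
  conj_q : q.HolderConjugate q'
  q_le_two : q ≤ 2
  q_le_p : q ≤ p
  p_le_q' : p ≤ q'

variable {A : BlockMatrix d} {p p' q q' : ℝ≥0∞}

theorem integrable_slice_coe [Fact (1 ≤ p)] [Fact (1 ≤ p')]
    (hreg : RightRegular A) (hp : p.HolderConjugate p')
    (f : Lp ℂ p (volume : Measure (Rd d))) (g : Lp ℂ p' (volume : Measure (Rd d))) (x : Rd d) :
    Integrable (slice A g f x) :=
  integrable_slice hreg hp (Lp.stronglyMeasurable f).measurable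
    (Lp.stronglyMeasurable g).measurable (Lp.memLp f) (Lp.memLp g) x

theorem Admissible.memLp_mwd (h : Admissible A p p' q q')
    (f : Lp ℂ p (volume : Measure (Rd d))) (g : Lp ℂ p' (volume : Measure (Rd d))) :
    MemLp (mwd A g f) q' volume := by
  refine ⟨(stronglyMeasurable_mwd A (Lp.stronglyMeasurable f).measurable
    (Lp.stronglyMeasurable g).measurable).aestronglyMeasurable,
    (eLpNorm_mwd_le h.isUnit h.rightRegular h.conj_p h.conj_q h.q_le_two h.q_le_p h.p_le_q'
    (Lp.stronglyMeasurable f).measurable (Lp.stronglyMeasurable g).measurable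
    (Lp.memLp f) (Lp.memLp g)).trans_lt ?_⟩
  exact ENNReal.mul_lt_top ENNReal.ofReal_lt_top (ENNReal.mul_lt_top (Lp.memLp g).2 (Lp.memLp f).2)

theorem Admissible.integrable_form (h : Admissible A p p' q q')
    (σ : Lp ℂ q (volume : Measure (Rd d × Rd d)))
    (f : Lp ℂ p (volume : Measure (Rd d))) (g : Lp ℂ p' (volume : Measure (Rd d))) :
    Integrable (fun z => σ z * conj (mwd A g f z)) volume :=
  integrable_mul_conj h.conj_q (Lp.memLp σ) (h.memLp_mwd f g)

theorem Admissible.norm_opForm_le [Fact (1 ≤ p)] [Fact (1 ≤ p')] [Fact (1 ≤ q)]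
    (h : Admissible A p p' q q') (σ : Lp ℂ q (volume : Measure (Rd d × Rd d)))
    (f : Lp ℂ p (volume : Measure (Rd d))) (g : Lp ℂ p' (volume : Measure (Rd d))) :
    ‖opForm A σ f g‖ ≤ mwdConst A p p' q' * ‖σ‖ * ‖f‖ * ‖g‖ := by
  have h1 := enorm_bracket_le h.conj_q (Lp.aestronglyMeasurable σ) (h.memLp_mwd f g).1
  have h2 := eLpNorm_mwd_le h.isUnit h.rightRegular h.conj_p h.conj_q h.q_le_two h.q_le_p
    h.p_le_q' (Lp.stronglyMeasurable f).measurable (Lp.stronglyMeasurable g).measurable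
    (Lp.memLp f) (Lp.memLp g)
  have h3 := h1.trans (mul_le_mul_right h2 _)
  have hC := mwdConst_nonneg A p p' q'
  rw [← Lp.enorm_def, ← Lp.enorm_def, ← Lp.enorm_def, ← ofReal_norm, ← ofReal_norm,
    ← ofReal_norm, ← ofReal_norm, ← ENNReal.ofReal_mul (norm_nonneg _), ← ENNReal.ofReal_mul hC,
    ← ENNReal.ofReal_mul (norm_nonneg _), ENNReal.ofReal_le_ofReal_iff (by positivity)] at h3
  refine le_trans h3 (le_of_eq ?_)
  ring

theorem mwd_coe_add [Fact (1 ≤ p)] [Fact (1 ≤ p')]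
    (hreg : RightRegular A) (hp : p.HolderConjugate p')
    (f f' : Lp ℂ p (volume : Measure (Rd d))) (g : Lp ℂ p' (volume : Measure (Rd d))) :
    mwd A g (⇑(f + f')) = mwd A g f + mwd A g f' := by
  rw [mwd_congr hreg Filter.EventuallyEq.rfl (Lp.coeFn_add f f')]
  funext z
  rw [Pi.add_apply]
  change 𝓕 (slice A g (⇑f + ⇑f') z.1) z.2 = 𝓕 (slice A g f z.1) z.2 + 𝓕 (slice A g f' z.1) z.2
  rw [← fourier_add_apply (integrable_slice_coe hreg hp f g z.1)
    (integrable_slice_coe hreg hp f' g z.1)]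
  refine congrArg (fun u : Rd d → ℂ => 𝓕 u z.2) (funext fun y => ?_)
  simp only [slice, Pi.add_apply, map_add]
  ring

theorem mwd_coe_smul [Fact (1 ≤ p)] [Fact (1 ≤ p')]
    (hreg : RightRegular A) (hp : p.HolderConjugate p') (c : ℂ)
    (f : Lp ℂ p (volume : Measure (Rd d))) (g : Lp ℂ p' (volume : Measure (Rd d))) :
    mwd A g (⇑(c • f)) = conj c • mwd A g f := by
  rw [mwd_congr hreg Filter.EventuallyEq.rfl (Lp.coeFn_smul c f)]
  funext z
  rw [Pi.smul_apply, smul_eq_mul]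
  change 𝓕 (slice A g (c • ⇑f) z.1) z.2 = conj c * 𝓕 (slice A g f z.1) z.2
  rw [← fourier_const_mul_apply (integrable_slice_coe hreg hp f g z.1)]
  refine congrArg (fun u : Rd d → ℂ => 𝓕 u z.2) (funext fun y => ?_)
  simp only [slice, Pi.smul_apply, smul_eq_mul, map_mul]
  ring

theorem Admissible.opForm_add_symbol [Fact (1 ≤ p)] [Fact (1 ≤ p')] [Fact (1 ≤ q)]
    (h : Admissible A p p' q q') (σ τ : Lp ℂ q (volume : Measure (Rd d × Rd d)))
    (f : Lp ℂ p (volume : Measure (Rd d))) (g : Lp ℂ p' (volume : Measure (Rd d))) :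
    opForm A (⇑(σ + τ)) f g = opForm A σ f g + opForm A τ f g := by
  unfold opForm
  rw [bracket_congr (Lp.coeFn_add σ τ) Filter.EventuallyEq.rfl]
  exact bracket_add_left h.conj_q (Lp.memLp σ) (Lp.memLp τ) (h.memLp_mwd f g)

theorem opForm_smul_symbol [Fact (1 ≤ q)] (c : ℂ)
    (σ : Lp ℂ q (volume : Measure (Rd d × Rd d))) (f g : Rd d → ℂ) :
    opForm A (⇑(c • σ)) f g = c * opForm A σ f g := by
  unfold opForm
  rw [bracket_congr (Lp.coeFn_smul c σ) Filter.EventuallyEq.rfl]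
  exact bracket_smul_left c _ _

theorem Admissible.opForm_add [Fact (1 ≤ p)] [Fact (1 ≤ p')] [Fact (1 ≤ q)]
    (h : Admissible A p p' q q') (σ : Lp ℂ q (volume : Measure (Rd d × Rd d)))
    (f f' : Lp ℂ p (volume : Measure (Rd d))) (g : Lp ℂ p' (volume : Measure (Rd d))) :
    opForm A σ (⇑(f + f')) g = opForm A σ f g + opForm A σ f' g := by
  unfold opForm
  rw [mwd_coe_add h.rightRegular h.conj_p]
  exact bracket_add_right h.conj_q (Lp.memLp σ) (h.memLp_mwd f g) (h.memLp_mwd f' g)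

theorem Admissible.opForm_smul [Fact (1 ≤ p)] [Fact (1 ≤ p')]
    (h : Admissible A p p' q q') (c : ℂ) (σ : Rd d × Rd d → ℂ)
    (f : Lp ℂ p (volume : Measure (Rd d))) (g : Lp ℂ p' (volume : Measure (Rd d))) :
    opForm A σ (⇑(c • f)) g = c * opForm A σ f g := by
  unfold opForm
  rw [mwd_coe_smul h.rightRegular h.conj_p, bracket_smul_right, Complex.conj_conj]

theorem Admissible.opForm_sub_symbol [Fact (1 ≤ p)] [Fact (1 ≤ p')] [Fact (1 ≤ q)]
    (h : Admissible A p p' q q') (σ τ : Lp ℂ q (volume : Measure (Rd d × Rd d)))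
    (f : Lp ℂ p (volume : Measure (Rd d))) (g : Lp ℂ p' (volume : Measure (Rd d))) :
    opForm A (⇑(σ - τ)) f g = opForm A σ f g - opForm A τ f g := by
  have h1 : σ - τ = σ + (-1 : ℂ) • τ := by rw [neg_one_smul, sub_eq_add_neg]
  rw [h1, h.opForm_add_symbol, opForm_smul_symbol]
  ring

/-- `σ^A f` is represented by an element of `L^p`. -/
def Represents (A : BlockMatrix d) (p' : ℝ≥0∞) [Fact (1 ≤ p)]
    (σ : Rd d × Rd d → ℂ) (f h : Lp ℂ p (volume : Measure (Rd d))) : Prop :=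
  ∀ g : Lp ℂ p' (volume : Measure (Rd d)), bracket h g = opForm A σ f g

theorem Admissible.norm_le_of_represents [Fact (1 ≤ p)] [Fact (1 ≤ p')] [Fact (1 ≤ q)]
    (h : Admissible A p p' q q') {σ : Lp ℂ q (volume : Measure (Rd d × Rd d))}
    {f k : Lp ℂ p (volume : Measure (Rd d))} (hk : Represents A p' σ f k) :
    ‖k‖ ≤ mwdConst A p p' q' * ‖σ‖ * ‖f‖ := by
  have hC := mwdConst_nonneg A p p' q'
  refine norm_le_of_bracket h.conj_p k (by positivity) fun g => ?_
  rw [hk g]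
  exact h.norm_opForm_le σ f g

/-- The norm bound makes the representing element depend in a Lipschitz way on σ. Along a convergent
sequence of symbols the representatives are therefore Cauchy, and both sides of the identity pass to
the limit. -/
theorem Admissible.isClosed_representable [Fact (1 ≤ p)] [Fact (1 ≤ p')] [Fact (1 ≤ q)]
    (h : Admissible A p p' q q') (f : Lp ℂ p (volume : Measure (Rd d))) :
    IsClosed {σ : Lp ℂ q (volume : Measure (Rd d × Rd d)) | ∃ k, Represents A p' σ f k} := by
  have hC := mwdConst_nonneg A p p' q'
  refine IsSeqClosed.isClosed fun s σ hs hσ => ?_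
  choose k hk using hs
  have hdiff : ∀ m n, Represents A p' (⇑(s m - s n)) f (k m - k n) := fun m n g => by
    rw [bracket_coe_sub h.conj_p, h.opForm_sub_symbol, hk m g, hk n g]
  have hb : ∀ m n, dist (k m) (k n) ≤ (mwdConst A p p' q' * ‖f‖) * dist (s m) (s n) := by
    intro m n
    rw [dist_eq_norm, dist_eq_norm]
    refine (h.norm_le_of_represents (hdiff m n)).trans (le_of_eq ?_)
    ring
  have hcau : CauchySeq k := by
    have h1 := hσ.cauchySeq
    rw [Metric.cauchySeq_iff] at h1 ⊢
    intro ε hε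
    -- The added 1 avoids a division by zero when f = 0.
    have hpos : 0 < mwdConst A p p' q' * ‖f‖ + 1 := by positivity
    obtain ⟨N, hN⟩ := h1 (ε / (mwdConst A p p' q' * ‖f‖ + 1)) (by positivity)
    refine ⟨N, fun m hm n hn => ?_⟩
    have h2 := hN m hm n hn
    rw [lt_div_iff₀ hpos] at h2
    have h3 := hb m n
    have h4 : (0 : ℝ) ≤ dist (s m) (s n) := dist_nonneg
    nlinarith
  obtain ⟨k₀, hk₀⟩ := cauchySeq_tendsto_of_complete hcau
  refine ⟨k₀, fun g => ?_⟩
  have t1 : Filter.Tendsto (fun n => bracket (k n) g) Filter.atTop (nhds (bracket k₀ g)) := by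
    rw [tendsto_iff_norm_sub_tendsto_zero] at hk₀ ⊢
    refine squeeze_zero (fun _ => norm_nonneg _) (fun n => ?_) (by simpa using hk₀.mul_const ‖g‖)
    rw [← bracket_coe_sub h.conj_p]
    exact norm_bracket_le h.conj_p _ g
  have t2 : Filter.Tendsto (fun n => opForm A (s n) f g) Filter.atTop
      (nhds (opForm A σ f g)) := by
    rw [tendsto_iff_norm_sub_tendsto_zero] at hσ ⊢
    refine squeeze_zero (fun _ => norm_nonneg _) (fun n => ?_)
      (by simpa using hσ.const_mul (mwdConst A p p' q' * ‖f‖ * ‖g‖))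
    rw [← h.opForm_sub_symbol]
    refine (h.norm_opForm_le _ f g).trans (le_of_eq ?_)
    ring
  refine tendsto_nhds_unique t1 ?_
  simpa only [hk _ g] using t2

end Form

/-! ### The kernel of σ^A and construction of the quantization map. -/

section Kernel

variable {d : ℕ}

theorem integral_comp_affine {M : Matrix (Fin d) (Fin d) ℝ} (hM : IsUnit M) (v : Rd d)
    {G : Rd d → ℂ} (hG : StronglyMeasurable G) :
    ∫ y, G (v + Matrix.toEuclideanLin M y) = ((jac M).toReal : ℂ) * ∫ u, G u := by
  rw [← integral_map (φ := fun y => v + Matrix.toEuclideanLin M y)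
    (measurable_affine M v).aemeasurable hG.aestronglyMeasurable,
    map_affine_volume hM, integral_smul_measure, Complex.real_smul]

theorem toEuclideanLin_inv_apply {M : Matrix (Fin d) (Fin d) ℝ} (hM : IsUnit M) (y : Rd d) :
    Matrix.toEuclideanLin M⁻¹ (Matrix.toEuclideanLin M y) = y := by
  have h : M⁻¹ * M = 1 := Matrix.nonsing_inv_mul M ((Matrix.isUnit_iff_isUnit_det M).1 hM)
  change (Matrix.toLpLin 2 2 M⁻¹) ((Matrix.toLpLin 2 2 M) y) = y
  rw [Matrix.toLpLin_apply, Matrix.toLpLin_apply]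
  simp [Matrix.mulVec_mulVec, h]

/-- The kernel of `σ^A`, before integration in the phase space variable `z`:
`σ^A f (u) = ∫ quantKernel A σ f (z, u) dz`. -/
noncomputable def quantKernel (A : BlockMatrix d) (σ : Rd d × Rd d → ℂ) (f : Rd d → ℂ)
    (w : (Rd d × Rd d) × Rd d) : ℂ :=
  (jac A.toBlocks₁₂).toReal * (σ w.1 *
    (Complex.exp (((2 * Real.pi * inner ℝ (Matrix.toEuclideanLin A.toBlocks₁₂⁻¹
      (w.2 - Matrix.toEuclideanLin A.toBlocks₁₁ w.1.1)) w.1.2 : ℝ) : ℂ) * Complex.I) *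
      f (Matrix.toEuclideanLin A.toBlocks₂₁ w.1.1 + Matrix.toEuclideanLin A.toBlocks₂₂
        (Matrix.toEuclideanLin A.toBlocks₁₂⁻¹
          (w.2 - Matrix.toEuclideanLin A.toBlocks₁₁ w.1.1)))))

theorem continuous_toEuclideanLin (M : Matrix (Fin d) (Fin d) ℝ) :
    Continuous (Matrix.toEuclideanLin M : Rd d → Rd d) :=
  LinearMap.continuous_of_finiteDimensional (Matrix.toEuclideanLin M)

theorem measurable_quantKernel (A : BlockMatrix d) {σ : Rd d × Rd d → ℂ} {f : Rd d → ℂ}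
    (hσ : Measurable σ) (hf : Measurable f) : Measurable (quantKernel A σ f) := by
  have c11 := continuous_toEuclideanLin A.toBlocks₁₁
  have c21 := continuous_toEuclideanLin A.toBlocks₂₁
  have c22 := continuous_toEuclideanLin A.toBlocks₂₂
  have ci := continuous_toEuclideanLin A.toBlocks₁₂⁻¹
  have hy : Continuous fun w : (Rd d × Rd d) × Rd d => Matrix.toEuclideanLin A.toBlocks₁₂⁻¹
      (w.2 - Matrix.toEuclideanLin A.toBlocks₁₁ w.1.1) :=
    ci.comp (continuous_snd.sub (c11.comp (continuous_fst.comp continuous_fst)))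
  have hexp : Continuous fun w : (Rd d × Rd d) × Rd d =>
      Complex.exp (((2 * Real.pi * inner ℝ (Matrix.toEuclideanLin A.toBlocks₁₂⁻¹
        (w.2 - Matrix.toEuclideanLin A.toBlocks₁₁ w.1.1)) w.1.2 : ℝ) : ℂ) * Complex.I) := by
    have hi := hy.inner (𝕜 := ℝ) (continuous_snd.comp continuous_fst :
      Continuous fun w : (Rd d × Rd d) × Rd d => w.1.2)
    exact Complex.continuous_exp.comp
      ((Complex.continuous_ofReal.comp (continuous_const.mul hi)).mul continuous_const)
  have harg : Measurable fun w : (Rd d × Rd d) × Rd d =>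
      Matrix.toEuclideanLin A.toBlocks₂₁ w.1.1 + Matrix.toEuclideanLin A.toBlocks₂₂
        (Matrix.toEuclideanLin A.toBlocks₁₂⁻¹
          (w.2 - Matrix.toEuclideanLin A.toBlocks₁₁ w.1.1)) :=
    ((c21.comp (continuous_fst.comp continuous_fst)).add (c22.comp hy)).measurable
  exact measurable_const.mul ((hσ.comp measurable_fst).mul (hexp.measurable.mul (hf.comp harg)))

/-- Under u = A₁₁x + A₁₂y the expression A₁₂⁻¹(u - A₁₁x) in the kernel becomes y, which turns its
phase and its value of f into those of the conjugated integrand of 𝓑_A(g, f). -/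
theorem quantKernel_affine {A : BlockMatrix d} (hreg : RightRegular A) (σ : Rd d × Rd d → ℂ)
    (f g : Rd d → ℂ) (z : Rd d × Rd d) (y : Rd d) :
    quantKernel A σ f (z, Matrix.toEuclideanLin A.toBlocks₁₁ z.1 +
      Matrix.toEuclideanLin A.toBlocks₁₂ y) *
      conj (g (Matrix.toEuclideanLin A.toBlocks₁₁ z.1 + Matrix.toEuclideanLin A.toBlocks₁₂ y)) =
    (jac A.toBlocks₁₂).toReal * (σ z *
      conj (Complex.exp (((-2 * Real.pi * inner ℝ y z.2 : ℝ) : ℂ) * Complex.I) *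
        slice A g f z.1 y)) := by
  simp only [quantKernel, add_sub_cancel_left, toEuclideanLin_inv_apply hreg.1, slice, map_mul,
    Complex.conj_conj, ← Complex.exp_conj, Complex.conj_I, Complex.conj_ofReal]
  have h1 : ((-2 * Real.pi * inner ℝ y z.2 : ℝ) : ℂ) * -Complex.I =
      ((2 * Real.pi * inner ℝ y z.2 : ℝ) : ℂ) * Complex.I := by
    push_cast
    ring
  rw [h1]
  ring

theorem jac_toReal_ne_zero {M : Matrix (Fin d) (Fin d) ℝ} (hM : IsUnit M) :
    ((jac M).toReal : ℂ) ≠ 0 := by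
  have := ENNReal.toReal_pos (jac_ne_zero hM) (jac_ne_top M)
  exact_mod_cast this.ne'

theorem measurable_quantKernel_mul_conj (A : BlockMatrix d) {σ : Rd d × Rd d → ℂ}
    {f g : Rd d → ℂ} (hσ : Measurable σ) (hf : Measurable f) (hg : Measurable g) :
    Measurable fun w : (Rd d × Rd d) × Rd d => quantKernel A σ f w * conj (g w.2) :=
  (measurable_quantKernel A hσ hf).mul
    (Complex.continuous_conj.measurable.comp (hg.comp measurable_snd))

theorem integral_quantKernel_mul_conj {A : BlockMatrix d} (hreg : RightRegular A)
    {σ : Rd d × Rd d → ℂ} {f g : Rd d → ℂ} (hσ : Measurable σ) (hf : Measurable f)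
    (hg : Measurable g) (z : Rd d × Rd d) :
    ∫ u, quantKernel A σ f (z, u) * conj (g u) = σ z * conj (mwd A g f z) := by
  have hm : Measurable fun u : Rd d => quantKernel A σ f (z, u) * conj (g u) :=
    (measurable_quantKernel_mul_conj A hσ hf hg).comp measurable_prodMk_left
  have h1 := integral_comp_affine hreg.1 (Matrix.toEuclideanLin A.toBlocks₁₁ z.1)
    hm.stronglyMeasurable
  simp only [quantKernel_affine hreg] at h1
  rw [integral_const_mul] at h1
  have h2 := mul_left_cancel₀ (jac_toReal_ne_zero hreg.1) h1
  rw [← h2, integral_const_mul, integral_conj]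
  congr 2
  exact (Real.fourier_eq' (slice A g f z.1) z.2).symm

theorem lintegral_enorm_quantKernel_mul_conj {A : BlockMatrix d} (hreg : RightRegular A)
    {σ : Rd d × Rd d → ℂ} {f g : Rd d → ℂ} (hσ : Measurable σ) (hf : Measurable f)
    (hg : Measurable g) (z : Rd d × Rd d) :
    ∫⁻ u, ‖quantKernel A σ f (z, u) * conj (g u)‖ₑ =
      ‖σ z‖ₑ * eLpNorm (slice A g f z.1) 1 volume := by
  have hm : Measurable fun u : Rd d => quantKernel A σ f (z, u) * conj (g u) :=
    (measurable_quantKernel_mul_conj A hσ hf hg).comp measurable_prodMk_left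
  have h1 := lintegral_comp_affine hreg.1 (Matrix.toEuclideanLin A.toBlocks₁₁ z.1) hm.enorm
  simp only [quantKernel_affine hreg] at h1
  have h3 : ‖((jac A.toBlocks₁₂).toReal : ℂ)‖ₑ = jac A.toBlocks₁₂ := by
    rw [← ofReal_norm, Complex.norm_real, Real.norm_of_nonneg ENNReal.toReal_nonneg,
      ENNReal.ofReal_toReal (jac_ne_top _)]
  have h4 : ∀ t : ℝ, ‖Complex.exp ((t : ℂ) * Complex.I)‖ₑ = 1 := fun t => by
    rw [← ofReal_norm, Complex.norm_exp_ofReal_mul_I, ENNReal.ofReal_one]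
  simp only [enorm_mul, RCLike.enorm_conj, h3, h4, one_mul] at h1
  have hs : Measurable fun y => ‖slice A g f z.1 y‖ₑ := (measurable_slice_right A hf hg z.1).enorm
  rw [lintegral_const_mul _ (hs.const_mul _), lintegral_const_mul _ hs] at h1
  have h2 := (ENNReal.mul_right_inj (jac_ne_zero hreg.1) (jac_ne_top _)).1 h1
  rw [eLpNorm_one_eq_lintegral_enorm, h2]
  simp only [enorm_mul, RCLike.enorm_conj]

variable {A : BlockMatrix d} {p p' q q' : ℝ≥0∞}

/-- The L¹ norms of the slices are bounded uniformly in x, so integrability of σ alone suffices for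
Fubini. -/
theorem integrable_quantKernel_mul_conj (hreg : RightRegular A)
    (hp : p.HolderConjugate p') {σ : Rd d × Rd d → ℂ} {f g : Rd d → ℂ} (hσ : Measurable σ)
    (hσi : Integrable σ)
    (hfm : Measurable f) (hgm : Measurable g) (hf : MemLp f p volume) (hg : MemLp g p' volume) :
    Integrable (fun w : (Rd d × Rd d) × Rd d => quantKernel A σ f w * conj (g w.2))
      ((volume : Measure (Rd d × Rd d)).prod volume) := by
  have hm := measurable_quantKernel_mul_conj A hσ hfm hgm
  have h1 : ∫⁻ w, ‖quantKernel A σ f w * conj (g w.2)‖ₑ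
      ∂((volume : Measure (Rd d × Rd d)).prod volume) =
      ∫⁻ z, ‖σ z‖ₑ * eLpNorm (slice A g f z.1) 1 volume := by
    rw [lintegral_prod _ hm.enorm.aemeasurable]
    exact lintegral_congr fun z => lintegral_enorm_quantKernel_mul_conj hreg hσ hfm hgm z
  have h2 : ∫⁻ z, ‖σ z‖ₑ * eLpNorm (slice A g f z.1) 1 volume ≤
      ∫⁻ z, ‖σ z‖ₑ * (jac A.toBlocks₁₂ ^ (p'⁻¹).toReal * jac A.toBlocks₂₂ ^ (p⁻¹).toReal *
        (eLpNorm g p' volume * eLpNorm f p volume)) :=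
    lintegral_mono fun z => mul_le_mul_right (eLpNorm_slice_one_le hreg hp hfm hgm z.1) _
  refine ⟨hm.aestronglyMeasurable, ?_⟩
  rw [hasFiniteIntegral_iff_enorm, h1]
  refine h2.trans_lt ?_
  rw [lintegral_mul_const _ hσ.enorm]
  refine ENNReal.mul_lt_top hσi.2 (ENNReal.mul_lt_top (ENNReal.mul_lt_top ?_ ?_)
    (ENNReal.mul_lt_top hg.2 hf.2))
  · exact ENNReal.rpow_lt_top_of_nonneg ENNReal.toReal_nonneg (jac_ne_top _)
  · exact ENNReal.rpow_lt_top_of_nonneg ENNReal.toReal_nonneg (jac_ne_top _)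

theorem bracket_integral_quantKernel (hreg : RightRegular A)
    (hp : p.HolderConjugate p') {σ : Rd d × Rd d → ℂ} {f g : Rd d → ℂ} (hσ : Measurable σ)
    (hσi : Integrable σ)
    (hfm : Measurable f) (hgm : Measurable g) (hf : MemLp f p volume) (hg : MemLp g p' volume) :
    bracket (fun u => ∫ z, quantKernel A σ f (z, u)) g = opForm A σ f g := by
  have hint := integrable_quantKernel_mul_conj hreg hp hσ hσi hfm hgm hf hg
  unfold opForm bracket
  simp only [← integral_mul_const, ← integral_quantKernel_mul_conj hreg hσ hfm hgm]
  exact (integral_integral_swap (f := fun z u => quantKernel A σ f (z, u) * conj (g u)) hint).symm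

/-- The kernel integral k is at first only measurable. Fubini identifies its bracket with the form,
whose bound against all g in L^{p'} puts k in L^p by the converse of Hölder. -/
theorem Admissible.representable_of_integrable [Fact (1 ≤ p)] [Fact (1 ≤ p')] [Fact (1 ≤ q)]
    (h : Admissible A p p' q q') (σ : Lp ℂ q (volume : Measure (Rd d × Rd d)))
    (hσi : Integrable σ) (f : Lp ℂ p (volume : Measure (Rd d))) :
    ∃ k, Represents A p' σ f k := by
  have hσ := (Lp.stronglyMeasurable σ).measurable
  have hf := (Lp.stronglyMeasurable f).measurable
  set k : Rd d → ℂ := fun u => ∫ z, quantKernel A σ f (z, u) with hk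
  have hrep : ∀ g : Lp ℂ p' (volume : Measure (Rd d)), bracket k g = opForm A σ f g := fun g =>
    bracket_integral_quantKernel h.rightRegular h.conj_p hσ hσi hf
      (Lp.stronglyMeasurable g).measurable (Lp.memLp f) (Lp.memLp g)
  have hkm : AEStronglyMeasurable k volume :=
    (StronglyMeasurable.integral_prod_left' (μ := (volume : Measure (Rd d × Rd d)))
      (measurable_quantKernel A hσ hf).stronglyMeasurable).aestronglyMeasurable
  have hC := mwdConst_nonneg A p p' q'
  have hkp : MemLp k p volume := by
    refine ⟨hkm, (eLpNorm_le_of_bracket h.conj_p hkm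
      (C := ENNReal.ofReal (mwdConst A p p' q' * ‖σ‖ * ‖f‖)) fun g => ?_).trans_lt
      ENNReal.ofReal_lt_top⟩
    rw [hrep g, ← ofReal_norm, ← ofReal_norm, ← ENNReal.ofReal_mul (by positivity)]
    exact ENNReal.ofReal_le_ofReal (h.norm_opForm_le σ f g)
  refine ⟨hkp.toLp k, fun g => ?_⟩
  rw [bracket_congr hkp.coeFn_toLp Filter.EventuallyEq.rfl]
  exact hrep g

/-- As q is finite, simple functions are dense in L^q, and those lying in L^q are integrable;
closedness does the rest. -/
theorem Admissible.exists_represents [Fact (1 ≤ p)] [Fact (1 ≤ p')] [Fact (1 ≤ q)]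
    (h : Admissible A p p' q q') (σ : Lp ℂ q (volume : Measure (Rd d × Rd d)))
    (f : Lp ℂ p (volume : Measure (Rd d))) :
    ∃ k, Represents A p' σ f k := by
  have hqt : q ≠ ∞ := ne_top_of_le_ne_top ENNReal.ofNat_ne_top h.q_le_two
  have hq0 : q ≠ 0 := (zero_lt_one.trans_le h.conj_q.one_le).ne'
  refine (Lp.simpleFunc.denseRange (E := ℂ) (μ := (volume : Measure (Rd d × Rd d)))
    hqt).induction_on (p := fun σ => ∃ k, Represents A p' σ f k) σ
    (h.isClosed_representable f) fun s => ?_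
  refine h.representable_of_integrable _ ?_ f
  have h1 : Integrable (Lp.simpleFunc.toSimpleFunc s) volume :=
    SimpleFunc.integrable_iff_finMeasSupp.2
      ((SimpleFunc.memLp_iff_finMeasSupp hq0 hqt).1 (Lp.simpleFunc.memLp s))
  exact h1.congr (Lp.simpleFunc.toSimpleFunc_eq_toFun s)

/-- The bounded quantization map `σ ↦ σ^A`. -/
theorem Admissible.exists_quantization [Fact (1 ≤ p)] [Fact (1 ≤ p')] [Fact (1 ≤ q)]
    (h : Admissible A p p' q q') :
    ∃ Φ : Lp ℂ q (volume : Measure (Rd d × Rd d)) →L[ℂ]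
        (Lp ℂ p (volume : Measure (Rd d)) →L[ℂ] Lp ℂ p (volume : Measure (Rd d))),
      ∀ σ : Lp ℂ q (volume : Measure (Rd d × Rd d)), (∀ f, Represents A p' σ f (Φ σ f)) ∧ ‖Φ σ‖ ≤ mwdConst A p p' q' * ‖σ‖ := by
  choose T hT using fun (σ : Lp ℂ q (volume : Measure (Rd d × Rd d)))
    (f : Lp ℂ p (volume : Measure (Rd d))) => h.exists_represents σ f
  have hC := mwdConst_nonneg A p p' q'
  have hb : ∀ σ f, ‖T σ f‖ ≤ mwdConst A p p' q' * ‖σ‖ * ‖f‖ := fun σ f =>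
    h.norm_le_of_represents (hT σ f)
  -- The chosen representatives are unique, so T inherits linearity in σ and in f from the form.
  let L := LinearMap.mk₂ ℂ T
    (fun σ τ f => eq_of_bracket_eq h.conj_p fun g => by
      rw [bracket_coe_add h.conj_p, hT, hT, hT, h.opForm_add_symbol])
    (fun c σ f => eq_of_bracket_eq h.conj_p fun g => by
      rw [bracket_coe_smul, hT, hT, opForm_smul_symbol])
    (fun σ f f' => eq_of_bracket_eq h.conj_p fun g => by
      rw [bracket_coe_add h.conj_p, hT, hT, hT, h.opForm_add])
    (fun c σ f => eq_of_bracket_eq h.conj_p fun g => by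
      rw [bracket_coe_smul, hT, hT, h.opForm_smul])
  refine ⟨L.mkContinuous₂ (mwdConst A p p' q') hb, fun σ => ⟨fun f => hT σ f, ?_⟩⟩
  exact ContinuousLinearMap.opNorm_le_bound _ (by positivity) fun f => hb σ f

end Kernel

/-! ### Gaussians composed with invertible matrices belong to M¹. -/

section Gaussian

variable {d : ℕ}

theorem continuous_gaussianWindow : Continuous (gaussianWindow d) := by
  unfold gaussianWindow
  fun_prop

theorem gaussianWindow_eq_cexp (t : Rd d) :
    gaussianWindow d t = Complex.exp (-(Real.pi : ℂ) * ‖t‖ ^ 2) := by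
  simp [gaussianWindow]

theorem norm_gaussianWindow (t : Rd d) :
    ‖gaussianWindow d t‖ = Real.exp (-Real.pi * ‖t‖ ^ 2) := by
  rw [gaussianWindow, Complex.norm_real, Real.norm_of_nonneg (Real.exp_pos _).le]

theorem conj_gaussianWindow (t : Rd d) : conj (gaussianWindow d t) = gaussianWindow d t :=
  Complex.conj_ofReal _

theorem integrable_gaussianWindow : Integrable (gaussianWindow d) := by
  have h := GaussianFourier.integrable_cexp_neg_mul_sq_norm_add (V := Rd d) (b := (Real.pi : ℂ))
    (by simpa using Real.pi_pos) 0 0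
  refine h.congr (Filter.Eventually.of_forall fun t => ?_)
  simp [gaussianWindow_eq_cexp]

theorem memLp_gaussianWindow {r : ℝ≥0∞} (hr : 1 ≤ r) : MemLp (gaussianWindow d) r volume := by
  have hi : MemLp (gaussianWindow d) ∞ volume := by
    refine memLp_top_of_bound continuous_gaussianWindow.aestronglyMeasurable 1
      (Filter.Eventually.of_forall fun t => ?_)
    rw [norm_gaussianWindow, Real.exp_le_one_iff]
    have := Real.pi_pos
    nlinarith [sq_nonneg ‖t‖]
  by_cases ht : r = ∞
  · rw [ht]; exact hi
  · exact memLp_of_memLp_one_of_memLp_top (memLp_one_iff_integrable.2 integrable_gaussianWindow)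
      hi hr ht

/-- The Gaussian `t ↦ exp (-π |N t|²)`. -/
noncomputable def gaussianComp (N : Matrix (Fin d) (Fin d) ℝ) (t : Rd d) : ℂ :=
  gaussianWindow d (Matrix.toEuclideanLin N t)

theorem eLpNorm_gaussianComp {N : Matrix (Fin d) (Fin d) ℝ} (hN : IsUnit N) (r : ℝ≥0∞) :
    eLpNorm (gaussianComp N) r volume =
      jac N ^ (r⁻¹).toReal * eLpNorm (gaussianWindow d) r volume := by
  rw [← eLpNorm_comp_affine hN 0 continuous_gaussianWindow.measurable]
  simp only [zero_add]
  rfl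

theorem continuous_gaussianComp (N : Matrix (Fin d) (Fin d) ℝ) : Continuous (gaussianComp N) :=
  continuous_gaussianWindow.comp (continuous_toEuclideanLin N)

theorem memLp_gaussianComp {N : Matrix (Fin d) (Fin d) ℝ} (hN : IsUnit N) {r : ℝ≥0∞}
    (hr : 1 ≤ r) : MemLp (gaussianComp N) r volume := by
  refine ⟨(continuous_gaussianComp N).aestronglyMeasurable, ?_⟩
  rw [eLpNorm_gaussianComp hN]
  exact ENNReal.mul_lt_top
    (ENNReal.rpow_lt_top_of_nonneg ENNReal.toReal_nonneg (jac_ne_top N))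
    (memLp_gaussianWindow hr).2

theorem fourier_gaussianWindow : 𝓕 (gaussianWindow d) = gaussianWindow d := by
  funext w
  have h := fourier_gaussian_innerProductSpace (V := Rd d) (b := (Real.pi : ℂ))
    (by simpa using Real.pi_pos) w
  have h1 : (gaussianWindow d) = fun v : Rd d => Complex.exp (-(Real.pi : ℂ) * ‖v‖ ^ 2) :=
    funext gaussianWindow_eq_cexp
  have hpi : (Real.pi : ℂ) ≠ 0 := by exact_mod_cast Real.pi_ne_zero
  rw [h1, h, div_self hpi, Complex.one_cpow, one_mul]
  congr 1
  field_simp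

theorem inner_toEuclideanLin (N : Matrix (Fin d) (Fin d) ℝ) (x y : Rd d) :
    inner ℝ (Matrix.toEuclideanLin N x) y =
      inner ℝ x (Matrix.toEuclideanLin N.transpose y) := by
  rw [← Matrix.conjTranspose_eq_transpose_of_trivial, Matrix.toEuclideanLin_conjTranspose_eq_adjoint,
    LinearMap.adjoint_inner_right]

theorem fourier_gaussianComp {N : Matrix (Fin d) (Fin d) ℝ} (hN : IsUnit N) (w : Rd d) :
    𝓕 (gaussianComp N) w = (jac N).toReal * gaussianComp N⁻¹.transpose w := by
  have hc : Continuous fun u : Rd d =>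
      Complex.exp (((-2 * Real.pi * inner ℝ (Matrix.toEuclideanLin N⁻¹ u) w : ℝ) : ℂ) * Complex.I) *
        gaussianWindow d u := by
    have := continuous_toEuclideanLin N⁻¹
    have := continuous_gaussianWindow (d := d)
    fun_prop
  have h := integral_comp_affine hN 0 hc.stronglyMeasurable
  simp only [zero_add, toEuclideanLin_inv_apply hN, inner_toEuclideanLin N⁻¹] at h
  have h1 : 𝓕 (gaussianWindow d) (Matrix.toEuclideanLin N⁻¹.transpose w) = _ :=
    Real.fourier_eq' _ _
  have h2 : 𝓕 (gaussianComp N) w = _ := Real.fourier_eq' _ _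
  rw [fourier_gaussianWindow] at h1
  rw [h2, gaussianComp, h1]
  exact h

theorem integrable_fourier_gaussianComp {N : Matrix (Fin d) (Fin d) ℝ} (hN : IsUnit N) :
    Integrable (𝓕 (gaussianComp N)) := by
  rw [show 𝓕 (gaussianComp N) = _ from funext (fourier_gaussianComp hN)]
  refine Integrable.const_mul ?_ _
  rw [← memLp_one_iff_integrable]
  refine memLp_gaussianComp ?_ le_rfl
  rw [Matrix.isUnit_transpose]
  exact (Matrix.isUnit_nonsing_inv_iff).2 hN

theorem toEuclideanLin_mul_apply (M N : Matrix (Fin d) (Fin d) ℝ) (y : Rd d) :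
    Matrix.toEuclideanLin (M * N) y = Matrix.toEuclideanLin M (Matrix.toEuclideanLin N y) := by
  change (Matrix.toLpLin 2 2 (M * N)) y = (Matrix.toLpLin 2 2 M) ((Matrix.toLpLin 2 2 N) y)
  simp [Matrix.toLpLin_apply, Matrix.mulVec_mulVec]

theorem toEuclideanLin_one_apply (y : Rd d) :
    Matrix.toEuclideanLin (1 : Matrix (Fin d) (Fin d) ℝ) y = y := by
  change (Matrix.toLpLin 2 2 (1 : Matrix (Fin d) (Fin d) ℝ)) y = y
  simp

theorem norm_sq_toEuclideanLin (N : Matrix (Fin d) (Fin d) ℝ) (y : Rd d) :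
    ‖Matrix.toEuclideanLin N y‖ ^ 2 =
      inner ℝ (Matrix.toEuclideanLin (N.transpose * N) y) y := by
  rw [← real_inner_self_eq_norm_sq, real_inner_comm, inner_toEuclideanLin, real_inner_comm,
    toEuclideanLin_mul_apply]

open scoped MatrixOrder in
-- Supplies the matrix of the single Gaussian that results from multiplying exp(-π|Ny|²) by a
-- translate of the window.
theorem exists_transpose_mul_self (N : Matrix (Fin d) (Fin d) ℝ) :
    ∃ R : Matrix (Fin d) (Fin d) ℝ, IsUnit R ∧ R.transpose * R = N.transpose * N + 1 := by
  have h1 : (N.transpose * N).PosSemidef := by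
    rw [← Matrix.conjTranspose_eq_transpose_of_trivial]
    exact Matrix.posSemidef_conjTranspose_mul_self N
  have h2 : (N.transpose * N + 1).PosDef := Matrix.PosDef.one.posSemidef_add h1
  obtain ⟨R, hR⟩ := CStarAlgebra.nonneg_iff_eq_star_mul_self.1 h2.posSemidef.nonneg
  rw [Matrix.star_eq_conjTranspose, Matrix.conjTranspose_eq_transpose_of_trivial] at hR
  refine ⟨R, ?_, hR.symm⟩
  rw [Matrix.isUnit_iff_isUnit_det]
  have h3 := h2.det_pos
  rw [hR, Matrix.det_mul, Matrix.det_transpose] at h3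
  exact isUnit_iff_ne_zero.2 fun h0 => by simp [h0] at h3

/-- The point s is where the gradient in y vanishes, so the term linear in y - s drops out. -/
theorem complete_square {N R : Matrix (Fin d) (Fin d) ℝ}
    (hR : R.transpose * R = N.transpose * N + 1) {x s : Rd d}
    (hs : Matrix.toEuclideanLin (N.transpose * N + 1) s = x) (y : Rd d) :
    ‖Matrix.toEuclideanLin N y‖ ^ 2 + ‖y - x‖ ^ 2 =
      ‖Matrix.toEuclideanLin R (y - s)‖ ^ 2 + (‖Matrix.toEuclideanLin N s‖ ^ 2 + ‖s - x‖ ^ 2) := by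
  obtain ⟨t, rfl⟩ : ∃ t, y = t + s := ⟨y - s, by simp⟩
  have hs' : Matrix.toEuclideanLin N.transpose (Matrix.toEuclideanLin N s) + s = x := by
    rw [map_add, LinearMap.add_apply, toEuclideanLin_one_apply, toEuclideanLin_mul_apply] at hs
    exact hs
  have e1 : ‖Matrix.toEuclideanLin R t‖ ^ 2 = ‖Matrix.toEuclideanLin N t‖ ^ 2 + ‖t‖ ^ 2 := by
    rw [norm_sq_toEuclideanLin, hR, map_add, LinearMap.add_apply, toEuclideanLin_one_apply,
      inner_add_left, ← norm_sq_toEuclideanLin, real_inner_self_eq_norm_sq]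
  have e2 : inner ℝ (Matrix.toEuclideanLin N t) (Matrix.toEuclideanLin N s) + inner ℝ t (s - x) = 0 := by
    rw [inner_toEuclideanLin, ← inner_add_right, ← add_sub_assoc, hs', sub_self, inner_zero_right]
  rw [add_sub_cancel_right, e1, map_add, add_sub_assoc, norm_add_sq_real, norm_add_sq_real]
  linear_combination 2 * e2

theorem fourier_comp_sub (f : Rd d → ℂ) (s w : Rd d) :
    𝓕 (fun y => f (y - s)) w = Real.fourierChar (-inner ℝ s w) • 𝓕 f w := by
  have h := congrFun (VectorFourier.fourierIntegral_comp_add_right Real.fourierChar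
    (volume : Measure (Rd d)) (innerₗ (Rd d)) f (-s)) w
  simp only [← sub_eq_add_neg] at h
  rw [map_neg, LinearMap.neg_apply] at h
  exact h

theorem norm_fourier_comp_sub (f : Rd d → ℂ) (s w : Rd d) :
    ‖𝓕 (fun y => f (y - s)) w‖ = ‖𝓕 f w‖ := by
  rw [fourier_comp_sub, Circle.norm_smul]

/-- Completing the square writes the short-time Fourier transform as a unimodular factor times c(x)
times a Gaussian in ω, with c integrable. The test functions must lie in M¹ because `IsQuantization`
says nothing outside it. -/
theorem memM1_gaussianComp {N : Matrix (Fin d) (Fin d) ℝ} (hN : IsUnit N) :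
    MemM1 (gaussianComp N) := by
  refine ⟨memLp_gaussianComp hN one_le_two, ?_⟩
  obtain ⟨R, hRu, hR⟩ := exists_transpose_mul_self N
  set P := N.transpose * N + 1 with hP
  have hPu : IsUnit P := by
    rw [← hR]
    exact ((Matrix.isUnit_transpose R).2 hRu).mul hRu
  set S := Matrix.toEuclideanLin P⁻¹ with hS
  have hPS : ∀ x : Rd d, Matrix.toEuclideanLin P (S x) = x := fun x => by
    rw [hS, ← toEuclideanLin_mul_apply,
      Matrix.mul_nonsing_inv P ((Matrix.isUnit_iff_isUnit_det P).1 hPu), toEuclideanLin_one_apply]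
  have hSc : Continuous S := continuous_toEuclideanLin P⁻¹
  have hNc := continuous_toEuclideanLin N
  set c : Rd d → ℂ := fun x =>
    (Real.exp (-Real.pi * (‖Matrix.toEuclideanLin N (S x)‖ ^ 2 + ‖S x - x‖ ^ 2)) : ℂ) with hc
  have hformula : stft (gaussianWindow d) (gaussianComp N) = fun z =>
      Complex.exp (((2 * Real.pi * -inner ℝ (S z.1) z.2 : ℝ) : ℂ) * Complex.I) * (c z.1 * 𝓕 (gaussianComp R) z.2) := by
    funext z
    have h1 : (fun y : Rd d => gaussianComp N y * conj (gaussianWindow d (y - z.1))) =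
        fun y => c z.1 * gaussianComp R (y - S z.1) := by
      funext y
      rw [conj_gaussianWindow]
      simp only [gaussianComp, gaussianWindow, hc, ← Complex.ofReal_mul, ← Real.exp_add, ← mul_add]
      rw [complete_square hR (hPS z.1) y, add_comm (‖_‖ ^ 2)]
    have hi : Integrable (fun y => gaussianComp R (y - S z.1)) :=
      (memLp_one_iff_integrable.1 (memLp_gaussianComp hRu le_rfl)).comp_sub_right _
    rw [stft, h1, fourier_const_mul_apply hi, fourier_comp_sub, Circle.smul_def, smul_eq_mul,
      Real.fourierChar_apply]
    ring
  rw [hformula]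
  have hcont : Continuous c := by
    rw [hc]
    fun_prop
  have hFc : Continuous (𝓕 (gaussianComp R)) :=
    continuous_fourier (memLp_one_iff_integrable.1 (memLp_gaussianComp hRu le_rfl))
  have hci : Integrable c := by
    -- Dropping ‖S x - x‖² from the exponent leaves the Gaussian of the invertible matrix N P⁻¹ as a
    -- majorant of c.
    have hNS : IsUnit (N * P⁻¹) := hN.mul ((Matrix.isUnit_nonsing_inv_iff).2 hPu)
    refine (memLp_one_iff_integrable.1 (memLp_gaussianComp hNS le_rfl)).mono
      hcont.aestronglyMeasurable (Filter.Eventually.of_forall fun x => ?_)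
    rw [hc, gaussianComp, norm_gaussianWindow, toEuclideanLin_mul_apply, Complex.norm_real,
      Real.norm_of_nonneg (Real.exp_pos _).le, Real.exp_le_exp]
    have := Real.pi_pos
    nlinarith [sq_nonneg ‖S x - x‖, mul_nonneg this.le (sq_nonneg ‖S x - x‖)]
  have hprod : Integrable (fun z : Rd d × Rd d => c z.1 * 𝓕 (gaussianComp R) z.2) :=
    Integrable.mul_prod hci (integrable_fourier_gaussianComp hRu)
  refine hprod.bdd_mul (c := 1) ?_ (Filter.Eventually.of_forall fun z => ?_)
  · have : Continuous fun z : Rd d × Rd d =>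
        Complex.exp (((2 * Real.pi * -inner ℝ (S z.1) z.2 : ℝ) : ℂ) * Complex.I) := by fun_prop
    exact this.aestronglyMeasurable
  · exact (Complex.norm_exp_ofReal_mul_I _).le

theorem MemM1.congr {f f' : Rd d → ℂ} (hf : MemM1 f) (h : f =ᵐ[volume] f') : MemM1 f' := by
  refine ⟨hf.1.ae_eq h, ?_⟩
  have h1 : stft (gaussianWindow d) f = stft (gaussianWindow d) f' := by
    funext z
    refine Real.fourier_congr_ae ?_ z.2
    filter_upwards [h] with y hy
    rw [hy]
  rw [← h1]
  exact hf.2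

end Gaussian

/-! ### Testing the quantization map on Gaussians. -/

section Necessity

variable {d : ℕ}

/-- Weighted parallel-axis identity: the first term is the distance to the weighted mean of -a and
-b, which after translation carries all dependence on y. -/
theorem add_norm_sq_eq {r : ℝ} (a b : Rd d) :
    r ^ 2 * ‖a‖ ^ 2 + ‖b‖ ^ 2 =
      (1 + r ^ 2) * ‖(1 + r ^ 2)⁻¹ • (r ^ 2 • a + b)‖ ^ 2 +
        r ^ 2 / (1 + r ^ 2) * ‖a - b‖ ^ 2 := by
  have hc : 0 < 1 + r ^ 2 := by positivity
  rw [norm_smul, mul_pow, norm_add_sq_real, norm_sub_sq_real, norm_smul, inner_smul_left,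
    Real.norm_of_nonneg (by positivity), Real.norm_of_nonneg (by positivity)]
  simp only [conj_trivial]
  field_simp
  ring

theorem norm_fourier_gaussian {c : ℝ} (hc : 0 < c) (w : Rd d) :
    ‖𝓕 (fun v : Rd d => Complex.exp (-((Real.pi * c : ℝ) : ℂ) * ‖v‖ ^ 2)) w‖ =
      c⁻¹ ^ ((d : ℝ) / 2) * Real.exp (-Real.pi * ‖w‖ ^ 2 / c) := by
  have hpos : 0 < Real.pi * c := mul_pos Real.pi_pos hc
  rw [fourier_gaussian_innerProductSpace (by rw [Complex.ofReal_re]; exact hpos), norm_mul,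
    ← Complex.ofReal_div,
    Complex.norm_cpow_eq_rpow_re_of_pos (div_pos Real.pi_pos hpos), Complex.norm_exp]
  have h1 : Real.pi / (Real.pi * c) = c⁻¹ := by
    have := Real.pi_pos
    field_simp
  have h2 : (-(Real.pi : ℂ) ^ 2 * (‖w‖ : ℂ) ^ 2 / ((Real.pi * c : ℝ) : ℂ)) =
      ((-Real.pi * ‖w‖ ^ 2 / c : ℝ) : ℂ) := by
    have : (Real.pi : ℂ) ≠ 0 := by exact_mod_cast Real.pi_ne_zero
    have : (c : ℂ) ≠ 0 := by exact_mod_cast hc.ne'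
    push_cast
    field_simp
  have h3 : ((Module.finrank ℝ (Rd d) : ℂ) / 2).re = (d : ℝ) / 2 := by
    simp
  rw [h1, h2, h3, Complex.ofReal_re]

/-- The modulus of the matrix-Wigner distribution of a pair of Gaussians adapted to the blocks
`A₁₂` and `A₂₂`. -/
theorem norm_mwd_gaussianComp {A : BlockMatrix d} (hreg : RightRegular A) (r : ℝ) (x ω : Rd d) :
    ‖mwd A (gaussianComp (r • A.toBlocks₁₂⁻¹)) (gaussianComp A.toBlocks₂₂⁻¹) (x, ω)‖ =
      (1 + r ^ 2)⁻¹ ^ ((d : ℝ) / 2) * Real.exp (-Real.pi * ‖ω‖ ^ 2 / (1 + r ^ 2)) *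
      Real.exp (-Real.pi * (r ^ 2 / (1 + r ^ 2) *
        ‖Matrix.toEuclideanLin (A.toBlocks₁₂⁻¹ * A.toBlocks₁₁ -
          A.toBlocks₂₂⁻¹ * A.toBlocks₂₁) x‖ ^ 2)) := by
  have hc : 0 < 1 + r ^ 2 := by positivity
  set a := Matrix.toEuclideanLin (A.toBlocks₁₂⁻¹ * A.toBlocks₁₁) x with ha
  set b := Matrix.toEuclideanLin (A.toBlocks₂₂⁻¹ * A.toBlocks₂₁) x with hb
  set v := (1 + r ^ 2)⁻¹ • (r ^ 2 • a + b) with hv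
  set K : ℝ := Real.exp (-Real.pi * (r ^ 2 / (1 + r ^ 2) * ‖a - b‖ ^ 2)) with hK
  -- The matrices r A₁₂⁻¹ and A₂₂⁻¹ undo the blocks acting on y, so the exponent is r²|y + a|² + |y
  -- + b|², isotropic in y and centred at -v.
  have hslice : slice A (gaussianComp (r • A.toBlocks₁₂⁻¹)) (gaussianComp A.toBlocks₂₂⁻¹) x =
      fun y => (K : ℂ) * Complex.exp (-((Real.pi * (1 + r ^ 2) : ℝ) : ℂ) * ‖y - -v‖ ^ 2) := by
    funext y
    have e1 : Matrix.toEuclideanLin (r • A.toBlocks₁₂⁻¹) (Matrix.toEuclideanLin A.toBlocks₁₁ x +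
        Matrix.toEuclideanLin A.toBlocks₁₂ y) = r • (y + a) := by
      rw [map_smul, LinearMap.smul_apply, map_add, toEuclideanLin_inv_apply hreg.1,
        ← toEuclideanLin_mul_apply, add_comm]
    have e2 : Matrix.toEuclideanLin A.toBlocks₂₂⁻¹ (Matrix.toEuclideanLin A.toBlocks₂₁ x +
        Matrix.toEuclideanLin A.toBlocks₂₂ y) = y + b := by
      rw [map_add, toEuclideanLin_inv_apply hreg.2, ← toEuclideanLin_mul_apply, add_comm]
    have e3 : ‖r • (y + a)‖ ^ 2 + ‖y + b‖ ^ 2 =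
        (1 + r ^ 2) * ‖y - -v‖ ^ 2 + r ^ 2 / (1 + r ^ 2) * ‖a - b‖ ^ 2 := by
      rw [norm_smul, mul_pow, Real.norm_eq_abs, sq_abs, add_norm_sq_eq, add_sub_add_left_eq_sub]
      congr 4
      rw [hv, sub_neg_eq_add, eq_comm, ← sub_eq_zero]
      have h1 : y = (1 + r ^ 2)⁻¹ • ((1 + r ^ 2) • y) := by
        rw [smul_smul, inv_mul_cancel₀ hc.ne', one_smul]
      nth_rw 1 [h1]
      rw [← smul_add, ← smul_sub]
      convert smul_zero _ using 2
      module
    rw [slice, gaussianComp, gaussianComp, e1, e2, conj_gaussianWindow]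
    have e4 : (K : ℂ) * Complex.exp (-((Real.pi * (1 + r ^ 2) : ℝ) : ℂ) * ‖y - -v‖ ^ 2) =
        ((K * Real.exp (-(Real.pi * (1 + r ^ 2)) * ‖y - -v‖ ^ 2) : ℝ) : ℂ) := by
      push_cast
      rfl
    rw [e4, gaussianWindow, gaussianWindow, ← Complex.ofReal_mul, ← Real.exp_add, hK,
      ← Real.exp_add]
    congr 2
    linear_combination -Real.pi * e3
  have hi : Integrable fun y : Rd d =>
      Complex.exp (-((Real.pi * (1 + r ^ 2) : ℝ) : ℂ) * ‖y - -v‖ ^ 2) := by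
    have h := GaussianFourier.integrable_cexp_neg_mul_sq_norm_add (V := Rd d)
      (b := ((Real.pi * (1 + r ^ 2) : ℝ) : ℂ))
      (by rw [Complex.ofReal_re]; exact mul_pos Real.pi_pos hc) 0 0
    simp only [zero_mul, add_zero] at h
    exact h.comp_sub_right (-v)
  rw [mwd_apply, hslice, fourier_const_mul_apply hi, norm_mul,
    norm_fourier_comp_sub (fun y => Complex.exp (-((Real.pi * (1 + r ^ 2) : ℝ) : ℂ) * ‖y‖ ^ 2)),
    norm_fourier_gaussian hc, Complex.norm_real, Real.norm_of_nonneg (Real.exp_pos _).le,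
    map_sub, LinearMap.sub_apply, mul_comm]

theorem jac_smul {M : Matrix (Fin d) (Fin d) ℝ} {r : ℝ} (hr : 0 < r) :
    jac (r • M) = ENNReal.ofReal ((r ^ d)⁻¹) * jac M := by
  rw [jac, jac, Matrix.det_smul, abs_mul, abs_pow, abs_of_pos hr, mul_inv, Fintype.card_fin,
    ENNReal.ofReal_mul (by positivity)]

variable {p p' q : ℝ≥0∞} [Fact (1 ≤ p)] [Fact (1 ≤ q)]

/-- A symbol on `E` aligned with a given function `B`. -/
theorem exists_aligned_symbol {X : Type*} [MeasureSpace X] (q : ℝ≥0∞) [Fact (1 ≤ q)]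
    {B : X → ℂ} (hB : Measurable B) {E : Set X} (hE : MeasurableSet E) (hE0 : volume E ≠ 0)
    (hEt : volume E ≠ ∞) {M : ℝ} (hM : ∀ z ∈ E, ‖B z‖ ≤ M) :
    ∃ σ : Lp ℂ q (volume : Measure X), ‖σ‖ₑ ≤ volume E ^ (q⁻¹).toReal ∧
      ‖bracket σ B‖ₑ = ∫⁻ z in E, ‖B z‖ₑ := by
  have hq0 : q ≠ 0 := (zero_lt_one.trans_le (Fact.out : 1 ≤ q)).ne'
  obtain ⟨h, hh⟩ : ∃ h : X → ℂ, h = fun z => conj (B z) := ⟨_, rfl⟩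
  have hm : Measurable h := by
    rw [hh]
    exact Complex.continuous_conj.measurable.comp hB
  have hhM : ∀ z ∈ E, ‖h z‖ ≤ M := fun z hz => by
    rw [hh, RCLike.norm_conj]
    exact hM z hz
  have hσ : MemLp (dualTest h 1 E) q volume := memLp_dualTest hm le_rfl hE hEt hhM q
  refine ⟨hσ.toLp _, ?_, ?_⟩
  · rw [Lp.enorm_def, eLpNorm_congr_ae hσ.coeFn_toLp]
    have h1 : eLpNorm (dualTest h 1 E) q volume ≤
        eLpNorm (E.indicator fun _ => (1 : ℝ)) q volume := by
      refine eLpNorm_mono fun z => ?_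
      have h2 := dualTest_bound le_rfl hhM z
      rw [sub_self, Real.rpow_zero] at h2
      exact h2.trans (Real.le_norm_self _)
    refine h1.trans (le_of_eq ?_)
    rw [eLpNorm_indicator_const' hE hE0 hq0, enorm_one, one_mul, one_div, ENNReal.toReal_inv]
  · have h1 : bracket (hσ.toLp (dualTest h 1 E)) B = ∫ z, h z * dualTest h 1 E z := by
      rw [bracket_congr hσ.coeFn_toLp Filter.EventuallyEq.rfl]
      refine integral_congr_ae (Filter.Eventually.of_forall fun z => ?_)
      simp only [hh]
      exact mul_comm _ _
    rw [h1, enorm_integral_mul_dualTest hm le_rfl hE hEt hhM]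
    simp only [hh, RCLike.enorm_conj, ENNReal.rpow_one]

theorem enorm_opForm_le_of_isQuantization {A : BlockMatrix d} (hreg : RightRegular A)
    (hp : p.HolderConjugate p')
    (Φ : Lp ℂ q (volume : Measure (Rd d × Rd d)) →L[ℂ]
      (Lp ℂ p (volume : Measure (Rd d)) →L[ℂ] Lp ℂ p (volume : Measure (Rd d))))
    (hΦ : ∀ σ : Lp ℂ q (volume : Measure (Rd d × Rd d)), IsQuantization A p p' σ (Φ σ))
    {f g : Rd d → ℂ} (hf : MemLp f p volume)
    (hg : MemLp g p' volume) (hf1 : MemM1 f) (hg1 : MemM1 g)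
    (σ : Lp ℂ q (volume : Measure (Rd d × Rd d))) :
    ‖opForm A σ f g‖ₑ ≤ ‖Φ‖ₑ * ‖σ‖ₑ * eLpNorm f p volume * eLpNorm g p' volume := by
  have h1 := hΦ σ (hf.toLp f) (hg.toLp g) (hf1.congr hf.coeFn_toLp.symm)
    (hg1.congr hg.coeFn_toLp.symm)
  rw [bracket_congr Filter.EventuallyEq.rfl hg.coeFn_toLp, opForm,
    mwd_congr hreg hg.coeFn_toLp hf.coeFn_toLp] at h1
  rw [opForm, ← h1]
  refine (enorm_bracket_le hp (Lp.aestronglyMeasurable _) hg.1).trans ?_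
  rw [← Lp.enorm_def]
  have h2 : ‖Φ σ (hf.toLp f)‖ₑ ≤ ‖Φ σ‖ₑ * ‖hf.toLp f‖ₑ := (Φ σ).le_opENorm _
  have h3 : ‖Φ σ‖ₑ ≤ ‖Φ‖ₑ * ‖σ‖ₑ := Φ.le_opENorm σ
  have h4 : ‖hf.toLp f‖ₑ = eLpNorm f p volume := by
    rw [Lp.enorm_def, eLpNorm_congr_ae hf.coeFn_toLp]
  exact mul_le_mul_left (h2.trans (mul_le_mul' h3 h4.le)) _

/-- Testing the quantization map on a symbol aligned with `𝓑_A (g, f)` on a set `E`. -/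
theorem lintegral_mwd_le_of_isQuantization {A : BlockMatrix d} (hreg : RightRegular A)
    (hp : p.HolderConjugate p')
    (Φ : Lp ℂ q (volume : Measure (Rd d × Rd d)) →L[ℂ]
      (Lp ℂ p (volume : Measure (Rd d)) →L[ℂ] Lp ℂ p (volume : Measure (Rd d))))
    (hΦ : ∀ σ : Lp ℂ q (volume : Measure (Rd d × Rd d)), IsQuantization A p p' σ (Φ σ))
    {f g : Rd d → ℂ} (hfm : Measurable f) (hgm : Measurable g) (hf : MemLp f p volume)
    (hg : MemLp g p' volume) (hf1 : MemM1 f) (hg1 : MemM1 g)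
    {E : Set (Rd d × Rd d)} (hE : MeasurableSet E) (hE0 : volume E ≠ 0) (hEt : volume E ≠ ∞) :
    ∫⁻ z in E, ‖mwd A g f z‖ₑ ≤
      ‖Φ‖ₑ * volume E ^ (q⁻¹).toReal * eLpNorm f p volume * eLpNorm g p' volume := by
  have hKt : jac A.toBlocks₁₂ ^ (p'⁻¹).toReal * jac A.toBlocks₂₂ ^ (p⁻¹).toReal *
      (eLpNorm g p' volume * eLpNorm f p volume) ≠ ∞ :=
    ENNReal.mul_ne_top (ENNReal.mul_ne_top
      (ENNReal.rpow_ne_top_of_nonneg ENNReal.toReal_nonneg (jac_ne_top _))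
      (ENNReal.rpow_ne_top_of_nonneg ENNReal.toReal_nonneg (jac_ne_top _)))
      (ENNReal.mul_ne_top hg.2.ne hf.2.ne)
  have hM : ∀ z ∈ E, ‖mwd A g f z‖ ≤ (jac A.toBlocks₁₂ ^ (p'⁻¹).toReal *
      jac A.toBlocks₂₂ ^ (p⁻¹).toReal *
      (eLpNorm g p' volume * eLpNorm f p volume)).toReal := by
    intro z _
    rw [← toReal_enorm]
    exact ENNReal.toReal_mono hKt (enorm_mwd_le hreg hp hfm hgm z)
  obtain ⟨σ, hσ, hσB⟩ := exists_aligned_symbol q (stronglyMeasurable_mwd A hfm hgm).measurable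
    hE hE0 hEt hM
  rw [← hσB]
  refine (enorm_opForm_le_of_isQuantization hreg hp Φ hΦ hf hg hf1 hg1 σ).trans ?_
  gcongr

/-- The basic necessary inequality, obtained by testing on Gaussians. -/
theorem exists_bound_of_isQuantization {A : BlockMatrix d} (hreg : RightRegular A)
    (hp : p.HolderConjugate p')
    (Φ : Lp ℂ q (volume : Measure (Rd d × Rd d)) →L[ℂ]
      (Lp ℂ p (volume : Measure (Rd d)) →L[ℂ] Lp ℂ p (volume : Measure (Rd d))))
    (hΦ : ∀ σ : Lp ℂ q (volume : Measure (Rd d × Rd d)), IsQuantization A p p' σ (Φ σ)) :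
    ∃ C : ℝ, 0 ≤ C ∧ ∀ r : ℝ, 0 < r → ∀ E : Set (Rd d × Rd d), MeasurableSet E →
      volume E ≠ 0 → volume E ≠ ∞ → ∀ m : ℝ, 0 ≤ m →
      (∀ z ∈ E, m ≤ ‖mwd A (gaussianComp (r • A.toBlocks₁₂⁻¹))
        (gaussianComp A.toBlocks₂₂⁻¹) z‖) →
      m * volume.real E ≤ C * volume.real E ^ (q⁻¹).toReal * (r ^ d)⁻¹ ^ (p'⁻¹).toReal := by
  have h12 : IsUnit A.toBlocks₁₂⁻¹ := (Matrix.isUnit_nonsing_inv_iff).2 hreg.1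
  have h22 : IsUnit A.toBlocks₂₂⁻¹ := (Matrix.isUnit_nonsing_inv_iff).2 hreg.2
  have hfL : MemLp (gaussianComp A.toBlocks₂₂⁻¹) p volume := memLp_gaussianComp h22 hp.one_le
  have hwL : MemLp (gaussianWindow d) p' volume := memLp_gaussianWindow hp.symm.one_le
  -- C₀ collects all factors independent of r; the dilation enters only through ‖g‖_{p'}, as
  -- (r^d)^{-1/p'}.
  set C₀ := ‖Φ‖ₑ * eLpNorm (gaussianComp A.toBlocks₂₂⁻¹) p volume *
    (jac A.toBlocks₁₂⁻¹ ^ (p'⁻¹).toReal * eLpNorm (gaussianWindow d) p' volume) with hC₀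
  have hC₀t : C₀ ≠ ∞ := ENNReal.mul_ne_top (ENNReal.mul_ne_top enorm_ne_top hfL.2.ne)
    (ENNReal.mul_ne_top (ENNReal.rpow_ne_top_of_nonneg ENNReal.toReal_nonneg (jac_ne_top _))
      hwL.2.ne)
  refine ⟨C₀.toReal, ENNReal.toReal_nonneg, fun r hr E hE hE0 hEt m hm0 hm => ?_⟩
  have hgu : IsUnit (r • A.toBlocks₁₂⁻¹) := by
    rw [Matrix.isUnit_iff_isUnit_det, Matrix.det_smul]
    exact (isUnit_iff_ne_zero.2 (pow_ne_zero _ hr.ne')).mul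
      ((Matrix.isUnit_iff_isUnit_det _).1 h12)
  have h1 := lintegral_mwd_le_of_isQuantization hreg hp Φ hΦ
    (continuous_gaussianComp A.toBlocks₂₂⁻¹).measurable
    (continuous_gaussianComp (r • A.toBlocks₁₂⁻¹)).measurable hfL
    (memLp_gaussianComp hgu hp.symm.one_le) (memM1_gaussianComp h22) (memM1_gaussianComp hgu)
    hE hE0 hEt
  have h2 : ENNReal.ofReal m * volume E ≤ ∫⁻ z in E, ‖mwd A (gaussianComp (r • A.toBlocks₁₂⁻¹))
        (gaussianComp A.toBlocks₂₂⁻¹) z‖ₑ := by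
    rw [← setLIntegral_const]
    refine setLIntegral_mono' hE fun z hz => ?_
    rw [← ofReal_norm]
    exact ENNReal.ofReal_le_ofReal (hm z hz)
  have h3 := h2.trans h1
  rw [eLpNorm_gaussianComp hgu, jac_smul hr, ENNReal.mul_rpow_of_nonneg _ _
    ENNReal.toReal_nonneg] at h3
  have h4 : ‖Φ‖ₑ * volume E ^ (q⁻¹).toReal *
      eLpNorm (gaussianComp A.toBlocks₂₂⁻¹) p volume *
      (ENNReal.ofReal (r ^ d)⁻¹ ^ (p'⁻¹).toReal * jac A.toBlocks₁₂⁻¹ ^ (p'⁻¹).toReal *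
        eLpNorm (gaussianWindow d) p' volume) =
      C₀ * volume E ^ (q⁻¹).toReal * ENNReal.ofReal (r ^ d)⁻¹ ^ (p'⁻¹).toReal := by
    rw [hC₀]
    ring
  rw [h4] at h3
  have h5 := ENNReal.toReal_mono (ENNReal.mul_ne_top (ENNReal.mul_ne_top hC₀t
    (ENNReal.rpow_ne_top_of_nonneg ENNReal.toReal_nonneg hEt))
    (ENNReal.rpow_ne_top_of_nonneg ENNReal.toReal_nonneg ENNReal.ofReal_ne_top)) h3
  rwa [ENNReal.toReal_mul, ENNReal.toReal_mul, ENNReal.toReal_mul, ENNReal.toReal_ofReal hm0,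
    ← ENNReal.toReal_rpow, ← ENNReal.toReal_rpow, ENNReal.toReal_ofReal (by positivity)] at h5

end Necessity

/-! ### Scaling limits and the resulting conditions on the exponents. -/

section Scaling

variable {d : ℕ}

/-- The hypothesis 1 ≤ d enters here: it makes s^d unbounded. -/
theorem nonpos_of_forall_mul_rpow_le (hd : 1 ≤ d) {k C e : ℝ} (hk : 0 < k)
    (h : ∀ s : ℝ, 1 ≤ s → k * (s ^ d) ^ e ≤ C) : e ≤ 0 := by
  by_contra! he
  have h1 : Filter.Tendsto (fun s : ℝ => k * (s ^ d) ^ e) Filter.atTop Filter.atTop :=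
    ((tendsto_rpow_atTop he).comp (Filter.tendsto_pow_atTop (by omega))).const_mul_atTop hk
  obtain ⟨s, hs, hs1⟩ :=
    ((h1.eventually (Filter.eventually_gt_atTop C)).and (Filter.eventually_ge_atTop 1)).exists
  exact absurd (h s hs1) (not_le.2 hs)

theorem volume_real_ball_prod {s t : ℝ} (hs : 0 < s) (ht : 0 < t) :
    volume.real (Metric.ball (0 : Rd d) s ×ˢ Metric.ball (0 : Rd d) t) =
      volume.real (Metric.ball (0 : Rd d) 1) ^ 2 * (s ^ d * t ^ d) := by
  have h : ∀ {r : ℝ}, 0 < r → volume.real (Metric.ball (0 : Rd d) r) =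
      r ^ d * volume.real (Metric.ball (0 : Rd d) 1) := by
    intro r hr
    rw [measureReal_def, Measure.addHaar_ball_of_pos _ _ hr, ENNReal.toReal_mul,
      ENNReal.toReal_ofReal (by positivity), finrank_euclideanSpace_fin, measureReal_def]
  rw [Measure.volume_eq_prod, measureReal_prod_prod, h hs, h ht]
  ring

/-- Lower bound for the modulus of the matrix-Wigner distribution of Gaussians. -/
theorem exists_le_norm_mwd_gaussianComp {A : BlockMatrix d} (hreg : RightRegular A) :
    ∃ k : ℝ, 0 < k ∧ ∀ r s t : ℝ, 0 < r → 0 < s → 0 < t → t ^ 2 ≤ 1 + r ^ 2 →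
      r ^ 2 * s ^ 2 ≤ 1 + r ^ 2 → ∀ z ∈ Metric.ball (0 : Rd d) s ×ˢ Metric.ball (0 : Rd d) t,
        (1 + r ^ 2)⁻¹ ^ ((d : ℝ) / 2) * k ≤
          ‖mwd A (gaussianComp (r • A.toBlocks₁₂⁻¹)) (gaussianComp A.toBlocks₂₂⁻¹) z‖ := by
  set L := Matrix.toEuclideanLin (A.toBlocks₁₂⁻¹ * A.toBlocks₁₁ -
    A.toBlocks₂₂⁻¹ * A.toBlocks₂₁) with hL
  set κ := ‖LinearMap.toContinuousLinearMap L‖ with hκ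
  have hLκ : ∀ x, ‖L x‖ ≤ κ * ‖x‖ := fun x => (LinearMap.toContinuousLinearMap L).le_opNorm x
  -- The conditions on s and t keep the two exponents, in ω and in x, above -π and -πκ² on the
  -- product of balls.
  refine ⟨Real.exp (-Real.pi) * Real.exp (-Real.pi * κ ^ 2), by positivity, ?_⟩
  rintro r s t hr hs ht h1 h2 ⟨x, ω⟩ ⟨hx, hω⟩
  rw [mem_ball_zero_iff] at hx hω
  rw [norm_mwd_gaussianComp hreg, mul_assoc, ← hL]
  have hc : 0 < 1 + r ^ 2 := by positivity
  have hpi := Real.pi_pos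
  have e1 : ‖ω‖ ^ 2 / (1 + r ^ 2) ≤ 1 := by
    rw [div_le_one hc]
    exact (pow_le_pow_left₀ (norm_nonneg _) hω.le 2).trans h1
  have e2 : r ^ 2 / (1 + r ^ 2) * ‖L x‖ ^ 2 ≤ κ ^ 2 := by
    have h3 : ‖L x‖ ^ 2 ≤ κ ^ 2 * s ^ 2 := by
      rw [← mul_pow]
      refine pow_le_pow_left₀ (norm_nonneg _) ((hLκ x).trans ?_) 2
      exact mul_le_mul_of_nonneg_left hx.le (norm_nonneg _)
    rw [div_mul_eq_mul_div, div_le_iff₀ hc]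
    nlinarith [mul_le_mul_of_nonneg_left h3 (sq_nonneg r),
      mul_le_mul_of_nonneg_left h2 (sq_nonneg κ)]
  refine mul_le_mul_of_nonneg_left (mul_le_mul ?_ ?_ (Real.exp_pos _).le (Real.exp_pos _).le)
    (by positivity)
  · rw [Real.exp_le_exp, mul_div_assoc]
    nlinarith
  · rw [Real.exp_le_exp]
    nlinarith

theorem measure_ball_prod_ne_zero {s t : ℝ} (hs : 0 < s) (ht : 0 < t) :
    volume (Metric.ball (0 : Rd d) s ×ˢ Metric.ball (0 : Rd d) t) ≠ 0 := by
  rw [Measure.volume_eq_prod, Measure.prod_prod]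
  exact mul_ne_zero (Metric.measure_ball_pos _ _ hs).ne' (Metric.measure_ball_pos _ _ ht).ne'

theorem measure_ball_prod_ne_top (s t : ℝ) :
    volume (Metric.ball (0 : Rd d) s ×ˢ Metric.ball (0 : Rd d) t) ≠ ∞ := by
  rw [Measure.volume_eq_prod, Measure.prod_prod]
  exact ENNReal.mul_ne_top measure_ball_lt_top.ne measure_ball_lt_top.ne

variable {p p' q : ℝ≥0∞} [Fact (1 ≤ p)] [Fact (1 ≤ q)]

theorem toReal_inv_le_of_isQuantization (hd : 1 ≤ d) {A : BlockMatrix d} (hreg : RightRegular A)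
    (hp : p.HolderConjugate p')
    (Φ : Lp ℂ q (volume : Measure (Rd d × Rd d)) →L[ℂ]
      (Lp ℂ p (volume : Measure (Rd d)) →L[ℂ] Lp ℂ p (volume : Measure (Rd d))))
    (hΦ : ∀ σ : Lp ℂ q (volume : Measure (Rd d × Rd d)), IsQuantization A p p' σ (Φ σ)) :
    (p'⁻¹).toReal ≤ (q⁻¹).toReal ∧ 1 ≤ (q⁻¹).toReal + (p'⁻¹).toReal := by
  obtain ⟨C, hC, hbound⟩ := exists_bound_of_isQuantization hreg hp Φ hΦ
  obtain ⟨k, hk, hlow⟩ := exists_le_norm_mwd_gaussianComp hreg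
  set v := volume.real (Metric.ball (0 : Rd d) 1) ^ 2 with hv
  have hv0 : 0 < v := by
    have : 0 < volume.real (Metric.ball (0 : Rd d) 1) :=
      ENNReal.toReal_pos (Metric.measure_ball_pos _ _ one_pos).ne' measure_ball_lt_top.ne
    positivity
  have hmeas : ∀ s t : ℝ,
      MeasurableSet (Metric.ball (0 : Rd d) s ×ˢ Metric.ball (0 : Rd d) t) := fun s t =>
    measurableSet_ball.prod measurableSet_ball
  set k' := (2 : ℝ)⁻¹ ^ ((d : ℝ) / 2) * k with hk'
  have hk'0 : 0 < k' := by positivity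
  set a := (q⁻¹).toReal with ha
  set b := (p'⁻¹).toReal with hb
  constructor
  -- Regime r ≥ 1 on B(0,1) × B(0,r): the height is at least k' r^{-d}, since 1 + r² ≤ 2r², and the
  -- volume is v r^d. Hence (r^d)^{1/p' - 1/q} stays bounded.
  · rw [← sub_nonpos]
    refine nonpos_of_forall_mul_rpow_le hd (k := k' * v) (C := C * v ^ a) (by positivity)
      fun r hr => ?_
    have hr0 : 0 < r := by linarith
    have hB : 0 < r ^ d := by positivity
    have hm : (r ^ d)⁻¹ * k' ≤ (1 + r ^ 2)⁻¹ ^ ((d : ℝ) / 2) * k := by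
      have h1 : (r ^ d)⁻¹ = (r ^ 2)⁻¹ ^ ((d : ℝ) / 2) := by
        rw [Real.inv_rpow (by positivity), ← Real.rpow_natCast r 2, ← Real.rpow_mul hr0.le,
          ← Real.rpow_natCast]
        congr 2
        push_cast
        ring
      rw [hk', h1, ← mul_assoc, ← Real.mul_rpow (by positivity) (by positivity)]
      refine mul_le_mul_of_nonneg_right (Real.rpow_le_rpow (by positivity) ?_ (by positivity))
        hk.le
      rw [← mul_inv]
      exact inv_anti₀ (by positivity) (by nlinarith)
    have h := hbound r hr0 _ (hmeas 1 r) (measure_ball_prod_ne_zero one_pos hr0)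
      (measure_ball_prod_ne_top 1 r) ((r ^ d)⁻¹ * k') (by positivity) fun z hz =>
        hm.trans (hlow r 1 r hr0 one_pos hr0 (by linarith) (by linarith) z hz)
    rw [volume_real_ball_prod one_pos hr0, ← hv, one_pow, one_mul,
      Real.mul_rpow hv0.le hB.le, Real.inv_rpow hB.le] at h
    rw [Real.rpow_sub hB, mul_div_assoc', div_le_iff₀ (by positivity)]
    have hBb : 0 < (r ^ d) ^ b := by positivity
    have h2 := mul_le_mul_of_nonneg_right h hBb.le
    have e1 : (r ^ d)⁻¹ * k' * (v * r ^ d) * (r ^ d) ^ b = k' * v * (r ^ d) ^ b := by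
      field_simp
    have e2 : C * (v ^ a * (r ^ d) ^ a) * ((r ^ d) ^ b)⁻¹ * (r ^ d) ^ b =
        C * v ^ a * (r ^ d) ^ a := by
      field_simp
    rw [e1, e2] at h2
    exact h2
  -- Regime r = 1/s ≤ 1 on B(0,s) × B(0,1): the height is at least k', since 1 + r² ≤ 2, and the
  -- volume is v s^d. Hence (s^d)^{1 - 1/q - 1/p'} stays bounded.
  · have hgoal : 1 - a - b ≤ 0 := by
      refine nonpos_of_forall_mul_rpow_le hd (k := k' * v) (C := C * v ^ a) (by positivity)
        fun s hs => ?_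
      have hs0 : 0 < s := by linarith
      have hB : 0 < s ^ d := by positivity
      have hi0 : 0 < s⁻¹ := by positivity
      have hi1 : s⁻¹ ≤ 1 := inv_le_one_of_one_le₀ hs
      have hm : k' ≤ (1 + s⁻¹ ^ 2)⁻¹ ^ ((d : ℝ) / 2) * k := by
        refine mul_le_mul_of_nonneg_right (Real.rpow_le_rpow (by positivity) ?_ (by positivity))
          hk.le
        exact inv_anti₀ (by positivity) (by nlinarith)
      have hss : s⁻¹ ^ 2 * s ^ 2 = 1 := by
        rw [← mul_pow, inv_mul_cancel₀ hs0.ne', one_pow]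
      have h := hbound s⁻¹ hi0 _ (hmeas s 1) (measure_ball_prod_ne_zero hs0 one_pos)
        (measure_ball_prod_ne_top s 1) k' hk'0.le fun z hz =>
          hm.trans (hlow s⁻¹ s 1 hi0 hs0 one_pos (by nlinarith) (by nlinarith) z hz)
      rw [volume_real_ball_prod hs0 one_pos, ← hv, one_pow, mul_one,
        Real.mul_rpow hv0.le hB.le, inv_pow, inv_inv] at h
      rw [Real.rpow_sub hB, Real.rpow_sub hB, Real.rpow_one, mul_div_assoc', mul_div_assoc',
        div_le_iff₀ (by positivity), div_le_iff₀ (by positivity)]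
      refine le_trans (le_of_eq ?_) (h.trans (le_of_eq ?_)) <;> ring
    linarith

end Scaling

/-! ### From the scaling inequalities to the conditions on p and q. -/

section Main

variable {d : ℕ}

theorem le_of_toReal_inv_le {p q : ℝ≥0∞} (hp : 1 ≤ p) (hq : 1 ≤ q)
    (h : (p⁻¹).toReal ≤ (q⁻¹).toReal) : q ≤ p := by
  have hp0 : p⁻¹ ≠ ∞ := ENNReal.inv_ne_top.2 (zero_lt_one.trans_le hp).ne'
  have hq0 : q⁻¹ ≠ ∞ := ENNReal.inv_ne_top.2 (zero_lt_one.trans_le hq).ne'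
  exact ENNReal.inv_le_inv.1 ((ENNReal.toReal_le_toReal hp0 hq0).1 h)

theorem exponents_of_isQuantization (hd : 1 ≤ d) {A : BlockMatrix d} (hreg : RightRegular A)
    {p p' q q' : ℝ≥0∞} [Fact (1 ≤ p)] [Fact (1 ≤ q)]
    (hp : p.HolderConjugate p') (hq : q.HolderConjugate q')
    (Φ : Lp ℂ q (volume : Measure (Rd d × Rd d)) →L[ℂ]
      (Lp ℂ p (volume : Measure (Rd d)) →L[ℂ] Lp ℂ p (volume : Measure (Rd d))))
    (hΦ : ∀ σ : Lp ℂ q (volume : Measure (Rd d × Rd d)), IsQuantization A p p' σ (Φ σ)) :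
    q ≤ 2 ∧ q ≤ p ∧ p ≤ q' := by
  obtain ⟨h1, h2⟩ := toReal_inv_le_of_isQuantization hd hreg hp Φ hΦ
  have hpp := holderConjugate_toReal_inv_add hp
  have hqq := holderConjugate_toReal_inv_add hq
  refine ⟨le_of_toReal_inv_le one_le_two hq.one_le ?_,
    le_of_toReal_inv_le hp.one_le hq.one_le (by linarith),
    le_of_toReal_inv_le hq.symm.one_le hp.one_le (by linarith)⟩
  rw [ENNReal.toReal_inv, ENNReal.toReal_ofNat]
  linarith

end Main

end MatrixWigner

theorem mainTheorem5 (d : ℕ) (hd : 1 ≤ d) (A : MatrixWigner.BlockMatrix d)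
    (hA : IsUnit A) (hreg : MatrixWigner.RightRegular A)
    (p p' q q' : ℝ≥0∞) [Fact (1 ≤ p)] [Fact (1 ≤ q)]
    (hp : ENNReal.HolderConjugate p p') (hq : ENNReal.HolderConjugate q q') :
    ((∃ Φ : Lp ℂ q (volume : Measure (MatrixWigner.Rd d × MatrixWigner.Rd d)) →L[ℂ]
          (Lp ℂ p (volume : Measure (MatrixWigner.Rd d)) →L[ℂ]
            Lp ℂ p (volume : Measure (MatrixWigner.Rd d))),
        ∀ σ : Lp ℂ q (volume : Measure (MatrixWigner.Rd d × MatrixWigner.Rd d)),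
          MatrixWigner.IsQuantization A p p' σ (Φ σ)) ↔
      (q ≤ 2 ∧ q ≤ p ∧ p ≤ q')) ∧
    ((q ≤ 2 ∧ q ≤ p ∧ p ≤ q') →
      ∃ Φ : Lp ℂ q (volume : Measure (MatrixWigner.Rd d × MatrixWigner.Rd d)) →L[ℂ]
          (Lp ℂ p (volume : Measure (MatrixWigner.Rd d)) →L[ℂ]
            Lp ℂ p (volume : Measure (MatrixWigner.Rd d))),
        ∀ σ : Lp ℂ q (volume : Measure (MatrixWigner.Rd d × MatrixWigner.Rd d)),
          MatrixWigner.IsQuantization A p p' σ (Φ σ) ∧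
          (∀ (f : Lp ℂ p (volume : Measure (MatrixWigner.Rd d)))
            (g : Lp ℂ p' (volume : Measure (MatrixWigner.Rd d))),
            Integrable (fun z => σ z * conj (MatrixWigner.mwd A g f z)) volume ∧
            MatrixWigner.bracket (Φ σ f) g = MatrixWigner.opForm A σ f g) ∧
          ‖Φ σ‖ ≤ ‖σ‖ /
            (|A.det| ^ (q'⁻¹).toReal *
              |A.toBlocks₁₂.det| ^ ((p'⁻¹).toReal - (q'⁻¹).toReal) *
              |A.toBlocks₂₂.det| ^ ((p⁻¹).toReal - (q'⁻¹).toReal))) := by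
  have suff : (q ≤ 2 ∧ q ≤ p ∧ p ≤ q') → _ := fun ⟨h2, hqp, hpq⟩ =>
    have : Fact (1 ≤ p') := ⟨hp.symm.one_le⟩
    have h : MatrixWigner.Admissible A p p' q q' := ⟨hA, hreg, hp, hq, h2, hqp, hpq⟩
    (⟨h, h.exists_quantization⟩ : MatrixWigner.Admissible A p p' q q' ∧
      ∃ Φ : Lp ℂ q (volume : Measure (MatrixWigner.Rd d × MatrixWigner.Rd d)) →L[ℂ]
        (Lp ℂ p (volume : Measure (MatrixWigner.Rd d)) →L[ℂ]
          Lp ℂ p (volume : Measure (MatrixWigner.Rd d))),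
        ∀ σ : Lp ℂ q (volume : Measure (MatrixWigner.Rd d × MatrixWigner.Rd d)),
          (∀ f, MatrixWigner.Represents A p' σ f (Φ σ f)) ∧
            ‖Φ σ‖ ≤ MatrixWigner.mwdConst A p p' q' * ‖σ‖)
  refine ⟨⟨fun ⟨Φ, hΦ⟩ => MatrixWigner.exponents_of_isQuantization hd hreg hp hq Φ hΦ,
    fun hc => ?_⟩, fun hc => ?_⟩
  · obtain ⟨_, Φ, hΦ⟩ := suff hc
    -- The identity holds on all of L^p × L^{p'}, so membership in M¹ is not called upon.
    exact ⟨Φ, fun σ f g _ _ => (hΦ σ).1 f g⟩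
  · obtain ⟨h, Φ, hΦ⟩ := suff hc
    refine ⟨Φ, fun σ => ⟨fun f g _ _ => (hΦ σ).1 f g,
      fun f g => ⟨h.integrable_form σ f g, (hΦ σ).1 f g⟩, ?_⟩⟩
    rw [div_eq_inv_mul]
    exact (hΦ σ).2
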